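/- Let $\mathbb{N}[\bar\rho,\rho,\bar\lambda,\lambda]$ be the polynomials in four variables with non-negative integer coefficients. **Smirnov trees.** A rooted binary tree (nonempty; each node has at most one left and at most one right child) whose nodes are labelled by positive integers is called Smirnov if the following holds: whenever the left (resp. right) child of a node has the same label $i$ as that node, then that node also has a right (resp. left) child, with label $<i$ (resp. $>i$). The edge between a node with label $a$ and its right child with label $b$ has weight $\bar\rho$ if $a\le b$ and $\rho$ if $a>b$; the edge between a left child with label $a$ and its parent with label $b$ has weight $\bar\lambda$ if $a\le b$ and $\lambda$ if $a>b$. A node with label $a$ has weight $x_a$. The weight $w(T)$ of a tree is the product of the weights of all its edges and nodes, and $G(x)=\sum_T w(T)$, the sum over all Smirnov trees, a formal power series in $x_1,x_2,\ldots$ with coefficients in $\mathbb{N}[\bar\rho,\rho,\bar\lambda,\lambda]$. **Bleeding trees.** A bleeding tree is an unordered rooted tree such that - nodes at even depth (including the root) are red and unlabelled, and nodes at odd depth are black and labelled with positive integers; - every red node has children, and it is joined by a red edge to exactly one of them; all other edges of the tree are black; - if a black node is joined to its parent by a black edge, its number of children is at most its label, and its label is not $1$; if it is joined to its parent by a red edge,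 its number of children is strictly smaller than its label. For a partition $\pi$, let $\mathcal{U}_\pi$ be the (finite) set of bleeding trees whose labels, with repetitions, are precisely the parts of $\pi$. **Weights.** A black node with label $r$ and $k$ children has weight $$p(r,k)=\sum_{i=1}^{r-1}\sum_{j=0}^{i}\binom ij\binom{r-i}{r-k-j}(\bar\rho\bar\lambda)^{i-j}(\bar\rho+\bar\lambda)^{j}(\rho\lambda)^{k-i+j}(\rho+\lambda)^{r-k-j}$$ if the edge to its parent is black, and $$\bar p(r,k)=\sum_{i=0}^{r-1}\sum_{j=0}^{i}\binom ij\binom{r-1-i}{r-1-k-j}(\bar\rho\bar\lambda)^{i-j}(\bar\rho+\bar\lambda)^{j}(\rho\lambda)^{k-i+j}(\rho+\lambda)^{r-1-k-j}$$ if the edge to its parent is red. Here $\binom nm=0$ unless $0\le m\le n$, and terms with a vanishing binomial coefficient are $0$. The weight $w(U)$ of a bleeding tree $U$ is the product of the weights of all its black nodes, times the number of distinct ordered trees that represent $U$; in an ordered tree the children of each node are linearly ordered, and the child of a red node that is joined to it by the red edge comes first. **Theorem.** The generating function $G(x)$ of Smirnov trees is $e$-positive, with coefficients in $\mathbb{N}[\bar\rho,\rho,\bar\lambda,\lambda]$: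 it is a (possibly infinite) linear combination, with coefficients in $\mathbb{N}[\bar\rho,\rho,\bar\lambda,\lambda]$, of products $e_\pi=\prod_i e_{\pi_i}$ of elementary symmetric functions in $x_1,x_2,\ldots$. More precisely, $$G(x)=\sum_{\pi}\Bigl(\sum_{U\in\mathcal{U}_\pi}w(U)\Bigr)e_\pi(x),$$ where the sum is over all partitions $\pi$ with $|\pi|\ge 1$. -/

import Mathlib

noncomputable section

/-! ### The coefficient ring and power series -/

/-- The four edge variables `ρ̄, ρ, λ̄, λ`. -/
inductive EdgeVar : Type
  | rhoBar | rho | lamBar | lam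

/-- The coefficient semiring `ℕ[ρ̄, ρ, λ̄, λ]`. -/
abbrev Coeff : Type := MvPolynomial EdgeVar ℕ

namespace Coeff

/-- The variable `ρ̄`. -/
def ρb : Coeff := MvPolynomial.X EdgeVar.rhoBar
/-- The variable `ρ`. -/
def ρ : Coeff := MvPolynomial.X EdgeVar.rho
/-- The variable `λ̄`. -/
def lb : Coeff := MvPolynomial.X EdgeVar.lamBar
/-- The variable `λ`. -/
def la : Coeff := MvPolynomial.X EdgeVar.lam

end Coeff

/-- Formal power series in `x₁, x₂, x₃, …` with coefficients in `ℕ[ρ̄, ρ, λ̄, λ]`. -/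
abbrev Series : Type := MvPowerSeries ℕ+ Coeff

/-! ### Smirnov trees -/

/-- The label of the root (`none` for the empty tree). -/
def rootLabel : BinaryTree ℕ+ → Option ℕ+
  | .nil => none
  | .node a _ _ => some a

/-- The Smirnov condition at every node; the empty tree is allowed here as a subtree. -/
def SmirnovCond : BinaryTree ℕ+ → Prop
  | .nil => True
  | .node i l r =>
      (rootLabel l = some i → ∃ c, rootLabel r = some c ∧ c < i) ∧
      (rootLabel r = some i → ∃ c, rootLabel l = some c ∧ i < c) ∧
      SmirnovCond l ∧ SmirnovCond r

/-- A Smirnov tree is a nonempty labelled rooted binary tree satisfying the Smirnov condition. -/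
def IsSmirnov (T : BinaryTree ℕ+) : Prop := T ≠ .nil ∧ SmirnovCond T

/-- The weight of the edge from a parent labelled `p` to its right child, if there is one:
`ρ̄` if `p ≤` the label of the child, and `ρ` otherwise. -/
def rightEdgeWeight (p : ℕ+) : Option ℕ+ → Coeff
  | none => 1
  | some b => if p ≤ b then Coeff.ρb else Coeff.ρ

/-- The weight of the edge from a parent labelled `p` to its left child, if there is one:
`λ̄` if the label of the child is `≤ p`, and `λ` otherwise. -/
def leftEdgeWeight (p : ℕ+) : Option ℕ+ → Coeff
  | none => 1
  | some c => if c ≤ p then Coeff.lb else Coeff.la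

/-- The product of the weights of all edges of a tree. -/
def edgeWeight : BinaryTree ℕ+ → Coeff
  | .nil => 1
  | .node i l r =>
      leftEdgeWeight i (rootLabel l) * rightEdgeWeight i (rootLabel r) *
        edgeWeight l * edgeWeight r

/-- The exponent of the product of the `x_a` over all nodes, `a` the label of the node:
`content T a` is the number of nodes with label `a`. -/
def content : BinaryTree ℕ+ → (ℕ+ →₀ ℕ)
  | .nil => 0
  | .node i l r => Finsupp.single i 1 + content l + content r

theorem finite_trees_aux (S : Set ℕ+) (hS : S.Finite) (n : ℕ) :
    {T : BinaryTree ℕ+ | T.numNodes ≤ n ∧ ∀ a, content T a ≠ 0 → a ∈ S}.Finite := by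
  induction n with
  | zero =>
    refine (Set.finite_singleton (BinaryTree.nil : BinaryTree ℕ+)).subset ?_
    rintro (_ | ⟨a, l, r⟩) ⟨h, _⟩
    · rfl
    · simp at h
  | succ n ih =>
    refine ((Set.finite_singleton (BinaryTree.nil : BinaryTree ℕ+)).union
      ((hS.prod (ih.prod ih)).image fun q => BinaryTree.node q.1 q.2.1 q.2.2)).subset ?_
    rintro (_ | ⟨a, l, r⟩) ⟨h, h'⟩
    · exact Or.inl rfl
    · refine Or.inr ⟨(a, l, r), ⟨?_, ⟨?_, ?_⟩, ?_, ?_⟩, rfl⟩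
      · exact h' a (by simp [content])
      · simp only [BinaryTree.numNodes] at h
        change l.numNodes ≤ n
        omega
      · exact fun b hb => h' b (by simp [content, hb])
      · simp only [BinaryTree.numNodes] at h
        change r.numNodes ≤ n
        omega
      · exact fun b hb => h' b (by simp [content, hb])

theorem degree_content (T : BinaryTree ℕ+) : (content T).degree = T.numNodes := by
  induction T with
  | nil => simp [content]
  | node a l r hl hr => simp [content, hl, hr]; ring

theorem finite_smirnov (m : ℕ+ →₀ ℕ) :
    {T : BinaryTree ℕ+ | IsSmirnov T ∧ content T = m}.Finite := by
  refine (finite_trees_aux m.support m.support.finite_toSet m.degree).subset ?_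
  rintro T ⟨-, rfl⟩
  exact ⟨(degree_content T).ge, fun a ha => by simpa using ha⟩

/-- The generating function `G(x)` of Smirnov trees, the sum of `w(T)` over all Smirnov trees `T`:
the coefficient of a monomial is the sum of the edge weights of the (finitely many) Smirnov
trees whose node weights multiply to this monomial. -/
def smirnovGF : Series := fun m => ∑ T ∈ (finite_smirnov m).toFinset, edgeWeight T

/-! ### Elementary symmetric functions -/

open Classical in
/-- The elementary symmetric function `e_n` in infinitely many variables: the sum of all
squarefree monomials of degree `n`. -/
def elemSymm (n : ℕ) : Series :=
  fun m => if m.degree = n ∧ ∀ a, m a ≤ 1 then 1 else 0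

/-- `e_π`, the product of `e_k` over the parts `k` of `π`. -/
def elemSymmPart {n : ℕ} (π : n.Partition) : Series := (π.parts.map elemSymm).prod

/-- All partitions of all integers `n ≥ 1`. -/
abbrev PosPartition : Type := Σ n : ℕ+, (n : ℕ).Partition

/-- `F = ∑_π c_π e_π` as formal power series: only finitely many terms of the sum contribute to
the coefficient of any given monomial, and their contributions add up to the coefficient of `F`. -/
def HasEExpansion (F : Series) (c : PosPartition → Coeff) : Prop :=
  ∀ m : ℕ+ →₀ ℕ,
    (Function.support fun π : PosPartition =>
      MvPowerSeries.coeff m (MvPowerSeries.C (c π) * elemSymmPart π.2)).Finite ∧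
    MvPowerSeries.coeff m F =
      ∑ᶠ π : PosPartition, MvPowerSeries.coeff m (MvPowerSeries.C (c π) * elemSymmPart π.2)

/-- `F` is `e`-positive with coefficients in `ℕ[ρ̄, ρ, λ̄, λ]`. -/
def IsEPositive (F : Series) : Prop := ∃ c : PosPartition → Coeff, HasEExpansion F c

/-! ### Ordered red/black trees -/

mutual
  /-- Ordered red/black trees with a red root. The root is unlabelled; it has exactly one child
  joined to it by a red edge, which comes first, and an ordered list of children joined to it by
  black edges. -/
  inductive RedTree : Type
    | node (redChild : BlackTree) (blackChildren : List BlackTree) : RedTree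
  /-- Ordered red/black trees with a black root. The root carries a positive integer, and has an
  ordered list of red children, joined to it by black edges. -/
  inductive BlackTree : Type
    | node (label : ℕ+) (children : List RedTree) : BlackTree
end

/-- The label of the root. -/
def BlackTree.label : BlackTree → ℕ+
  | .node r _ => r

/-- The number of children of the root. -/
def BlackTree.numChildren : BlackTree → ℕ
  | .node _ cs => cs.length

mutual
  /-- The multiset of all labels. -/
  def RedTree.labels : RedTree → Multiset ℕ
    | .node b bs => b.labels + labelsBlackList bs
  /-- The multiset of all labels. -/
  def BlackTree.labels : BlackTree → Multiset ℕ
    | .node r cs => {(r : ℕ)} + labelsRedList cs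
  /-- The multiset of all labels in a list of trees. -/
  def labelsBlackList : List BlackTree → Multiset ℕ
    | [] => 0
    | b :: bs => b.labels + labelsBlackList bs
  /-- The multiset of all labels in a list of trees. -/
  def labelsRedList : List RedTree → Multiset ℕ
    | [] => 0
    | t :: ts => t.labels + labelsRedList ts
end

mutual
  /-- The conditions on the labels of a bleeding tree: a black node joined to its parent by a red
  edge has fewer children than its label; a black node joined to its parent by a black edge has
  at most as many children as its label, and the label is not `1`. -/
  inductive RedTree.IsBleeding : RedTree → Prop
    | node {b : BlackTree} {bs : List BlackTree} :
        b.numChildren < (b.label : ℕ) → b.IsBleeding →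
        (∀ c ∈ bs, c.numChildren ≤ (c.label : ℕ) ∧ c.label ≠ 1) →
        (∀ c ∈ bs, c.IsBleeding) → RedTree.IsBleeding (.node b bs)
  /-- The same conditions for all black nodes except the root. -/
  inductive BlackTree.IsBleeding : BlackTree → Prop
    | node {r : ℕ+} {cs : List RedTree} :
        (∀ t ∈ cs, t.IsBleeding) → BlackTree.IsBleeding (.node r cs)
end

/-! ### Weights -/

/-- `∑_{j=0}^{i} C(i,j) C(n-i,n-k-j) (ρ̄λ̄)^{i-j} (ρ̄+λ̄)^j (ρλ)^{k-i+j} (ρ+λ)^{n-k-j}`, for `i ≤ n`,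
where the second binomial coefficient is `0` if `n - k - j < 0` (the terms with `k - i + j < 0`
vanish, because `n - k - j > n - i` for them). -/
def weightTerm (n k i : ℕ) : Coeff :=
  ∑ j ∈ Finset.range (i + 1),
    if k + j ≤ n then
      ((i.choose j * (n - i).choose (n - (k + j)) : ℕ) : Coeff) *
        (Coeff.ρb * Coeff.lb) ^ (i - j) * (Coeff.ρb + Coeff.lb) ^ j *
        (Coeff.ρ * Coeff.la) ^ (k + j - i) * (Coeff.ρ + Coeff.la) ^ (n - (k + j))
    else 0

/-- `p(r,k)`: the weight of a black node with label `r` and `k` children, joined to its parent by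
a black edge. -/
def pBlack (r k : ℕ) : Coeff := ∑ i ∈ Finset.Icc 1 (r - 1), weightTerm r k i

/-- `p̄(r,k)`: the weight of a black node with label `r ≥ 1` and `k` children, joined to its parent
by a red edge. -/
def pRed (r k : ℕ) : Coeff := ∑ i ∈ Finset.range r, weightTerm (r - 1) k i

mutual
  /-- The product of the weights of all black nodes. -/
  def RedTree.nodeWeight : RedTree → Coeff
    | .node b bs => b.nodeWeight pRed * nodeWeightBlackList bs
  /-- The product of the weights of all black nodes, where the weight of the root is given
  by `q`. -/
  def BlackTree.nodeWeight (q : ℕ → ℕ → Coeff) : BlackTree → Coeff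
    | .node r cs => q r cs.length * nodeWeightRedList cs
  /-- The product of the weights of all black nodes in the trees of a list, whose roots are joined
  to their common parent by black edges. -/
  def nodeWeightBlackList : List BlackTree → Coeff
    | [] => 1
    | b :: bs => b.nodeWeight pBlack * nodeWeightBlackList bs
  /-- The product of the weights of all black nodes in the trees of a list. -/
  def nodeWeightRedList : List RedTree → Coeff
    | [] => 1
    | t :: ts => t.nodeWeight * nodeWeightRedList ts
end

/-! ### Unordered trees

Two ordered trees represent the same unordered tree if one can be obtained from the other by
permuting the children of its nodes (preserving the colors of the edges). -/

mutual
  /-- Equality up to the order of the children. -/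
  inductive RedIso : RedTree → RedTree → Prop
    | node {b b' : BlackTree} {bs bs' : List BlackTree} :
        BlackIso b b' → BlackListIso bs bs' → RedIso (.node b bs) (.node b' bs')
  /-- Equality up to the order of the children. -/
  inductive BlackIso : BlackTree → BlackTree → Prop
    | node {r : ℕ+} {cs cs' : List RedTree} :
        RedListIso cs cs' → BlackIso (.node r cs) (.node r cs')
  /-- Lists which agree up to the order of their entries and up to `BlackIso`. -/
  inductive BlackListIso : List BlackTree → List BlackTree → Prop
    | nil : BlackListIso [] []
    | cons {b b' : BlackTree} {bs bs' : List BlackTree} :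
        BlackIso b b' → BlackListIso bs bs' → BlackListIso (b :: bs) (b' :: bs')
    | swap (b b' : BlackTree) (bs : List BlackTree) : BlackListIso (b :: b' :: bs) (b' :: b :: bs)
    | trans {bs bs' bs'' : List BlackTree} :
        BlackListIso bs bs' → BlackListIso bs' bs'' → BlackListIso bs bs''
  /-- Lists which agree up to the order of their entries and up to `RedIso`. -/
  inductive RedListIso : List RedTree → List RedTree → Prop
    | nil : RedListIso [] []
    | cons {t t' : RedTree} {ts ts' : List RedTree} :
        RedIso t t' → RedListIso ts ts' → RedListIso (t :: ts) (t' :: ts')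
    | swap (t t' : RedTree) (ts : List RedTree) : RedListIso (t :: t' :: ts) (t' :: t :: ts)
    | trans {ts ts' ts'' : List RedTree} :
        RedListIso ts ts' → RedListIso ts' ts'' → RedListIso ts ts''
end

mutual
  theorem RedIso.refl : ∀ t : RedTree, RedIso t t
    | .node b bs => .node (BlackIso.refl b) (BlackListIso.refl bs)
  theorem BlackIso.refl : ∀ b : BlackTree, BlackIso b b
    | .node _ cs => .node (RedListIso.refl cs)
  theorem BlackListIso.refl : ∀ bs : List BlackTree, BlackListIso bs bs
    | [] => .nil
    | b :: bs => .cons (BlackIso.refl b) (BlackListIso.refl bs)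
  theorem RedListIso.refl : ∀ ts : List RedTree, RedListIso ts ts
    | [] => .nil
    | t :: ts => .cons (RedIso.refl t) (RedListIso.refl ts)
end

mutual
  theorem RedIso.symm : ∀ {t t' : RedTree}, RedIso t t' → RedIso t' t
    | _, _, .node h h' => .node h.symm h'.symm
  theorem BlackIso.symm : ∀ {b b' : BlackTree}, BlackIso b b' → BlackIso b' b
    | _, _, .node h => .node h.symm
  theorem BlackListIso.symm :
      ∀ {bs bs' : List BlackTree}, BlackListIso bs bs' → BlackListIso bs' bs
    | _, _, .nil => .nil
    | _, _, .cons h h' => .cons h.symm h'.symm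
    | _, _, .swap b b' bs => .swap b' b bs
    | _, _, .trans h h' => .trans h'.symm h.symm
  theorem RedListIso.symm :
      ∀ {ts ts' : List RedTree}, RedListIso ts ts' → RedListIso ts' ts
    | _, _, .nil => .nil
    | _, _, .cons h h' => .cons h.symm h'.symm
    | _, _, .swap b b' bs => .swap b' b bs
    | _, _, .trans h h' => .trans h'.symm h.symm
end

theorem BlackIso.trans {b b' b'' : BlackTree} (h : BlackIso b b') (h' : BlackIso b' b'') :
    BlackIso b b'' := by
  cases h with
  | node h => cases h' with
    | node h' => exact .node (h.trans h')

theorem RedIso.trans {t t' t'' : RedTree} (h : RedIso t t') (h' : RedIso t' t'') :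
    RedIso t t'' := by
  cases h with
  | node h k => cases h' with
    | node h' k' => exact .node (h.trans h') (k.trans k')

instance RedTree.setoid : Setoid RedTree := ⟨RedIso, RedIso.refl, RedIso.symm, RedIso.trans⟩

mutual
  theorem RedIso.labels_eq : ∀ {t t' : RedTree}, RedIso t t' → t.labels = t'.labels
    | _, _, .node h h' => by
      simp only [RedTree.labels, h.labels_eq, h'.labels_eq]
  theorem BlackIso.labels_eq : ∀ {b b' : BlackTree}, BlackIso b b' → b.labels = b'.labels
    | _, _, .node h => by simp only [BlackTree.labels, h.labels_eq]
  theorem BlackListIso.labels_eq : ∀ {bs bs' : List BlackTree}, BlackListIso bs bs' →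
      labelsBlackList bs = labelsBlackList bs'
    | _, _, .nil => rfl
    | _, _, .cons h h' => by simp only [labelsBlackList, h.labels_eq, h'.labels_eq]
    | _, _, .swap _ _ _ => by simp only [labelsBlackList, add_left_comm]
    | _, _, .trans h h' => h.labels_eq.trans h'.labels_eq
  theorem RedListIso.labels_eq : ∀ {ts ts' : List RedTree}, RedListIso ts ts' →
      labelsRedList ts = labelsRedList ts'
    | _, _, .nil => rfl
    | _, _, .cons h h' => by simp only [labelsRedList, h.labels_eq, h'.labels_eq]
    | _, _, .swap _ _ _ => by simp only [labelsRedList, add_left_comm]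
    | _, _, .trans h h' => h.labels_eq.trans h'.labels_eq
end

theorem RedListIso.length_eq {ts ts' : List RedTree} (h : RedListIso ts ts') :
    ts.length = ts'.length := by
  refine RedListIso.rec (motive_1 := fun _ _ _ => True) (motive_2 := fun _ _ _ => True)
    (motive_3 := fun _ _ _ => True) (motive_4 := fun ts ts' _ => ts.length = ts'.length)
    ?_ ?_ ?_ ?_ ?_ ?_ ?_ ?_ ?_ ?_ h <;> simp +contextual

theorem BlackIso.label_eq {b b' : BlackTree} (h : BlackIso b b') : b.label = b'.label := by
  cases h; rfl

theorem BlackIso.numChildren_eq {b b' : BlackTree} (h : BlackIso b b') :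
    b.numChildren = b'.numChildren := by
  cases h with
  | node h => exact h.length_eq

mutual
  theorem RedIso.nodeWeight_eq : ∀ {t t' : RedTree}, RedIso t t' → t.nodeWeight = t'.nodeWeight
    | _, _, .node h h' => by
      simp only [RedTree.nodeWeight, h.nodeWeight_eq pRed, h'.nodeWeight_eq]
  theorem BlackIso.nodeWeight_eq (q : ℕ → ℕ → Coeff) :
      ∀ {b b' : BlackTree}, BlackIso b b' → b.nodeWeight q = b'.nodeWeight q
    | _, _, .node h => by simp only [BlackTree.nodeWeight, h.nodeWeight_eq, h.length_eq]
  theorem BlackListIso.nodeWeight_eq : ∀ {bs bs' : List BlackTree}, BlackListIso bs bs' →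
      nodeWeightBlackList bs = nodeWeightBlackList bs'
    | _, _, .nil => rfl
    | _, _, .cons h h' => by
      simp only [nodeWeightBlackList, h.nodeWeight_eq pBlack, h'.nodeWeight_eq]
    | _, _, .swap _ _ _ => by simp only [nodeWeightBlackList, mul_left_comm]
    | _, _, .trans h h' => h.nodeWeight_eq.trans h'.nodeWeight_eq
  theorem RedListIso.nodeWeight_eq : ∀ {ts ts' : List RedTree}, RedListIso ts ts' →
      nodeWeightRedList ts = nodeWeightRedList ts'
    | _, _, .nil => rfl
    | _, _, .cons h h' => by simp only [nodeWeightRedList, h.nodeWeight_eq, h'.nodeWeight_eq]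
    | _, _, .swap _ _ _ => by simp only [nodeWeightRedList, mul_left_comm]
    | _, _, .trans h h' => h.nodeWeight_eq.trans h'.nodeWeight_eq
end

mutual
  theorem RedIso.isBleeding : ∀ {t t' : RedTree}, RedIso t t' → t.IsBleeding → t'.IsBleeding
    | _, _, .node h h', .node h₁ h₂ h₃ h₄ =>
      .node (h.label_eq ▸ h.numChildren_eq ▸ h₁) (h.isBleeding h₂)
        (fun c hc => (h'.isBleeding (fun c hc => ⟨h₃ c hc, h₄ c hc⟩) c hc).1)
        (fun c hc => (h'.isBleeding (fun c hc => ⟨h₃ c hc, h₄ c hc⟩) c hc).2)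
  theorem BlackIso.isBleeding :
      ∀ {b b' : BlackTree}, BlackIso b b' → b.IsBleeding → b'.IsBleeding
    | _, _, .node h, .node h₁ => .node (h.isBleeding h₁)
  theorem BlackListIso.isBleeding : ∀ {bs bs' : List BlackTree}, BlackListIso bs bs' →
      (∀ c ∈ bs, (c.numChildren ≤ (c.label : ℕ) ∧ c.label ≠ 1) ∧ c.IsBleeding) →
      ∀ c ∈ bs', (c.numChildren ≤ (c.label : ℕ) ∧ c.label ≠ 1) ∧ c.IsBleeding
    | _, _, .nil, hb => hb
    | _, _, .cons h h', hb => by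
      rw [List.forall_mem_cons] at hb ⊢
      exact ⟨⟨h.label_eq ▸ h.numChildren_eq ▸ hb.1.1, h.isBleeding hb.1.2⟩, h'.isBleeding hb.2⟩
    | _, _, .swap _ _ _, hb => by
      simp only [List.forall_mem_cons] at hb ⊢
      exact ⟨hb.2.1, hb.1, hb.2.2⟩
    | _, _, .trans h h', hb => h'.isBleeding (h.isBleeding hb)
  theorem RedListIso.isBleeding : ∀ {ts ts' : List RedTree}, RedListIso ts ts' →
      (∀ t ∈ ts, t.IsBleeding) → ∀ t ∈ ts', t.IsBleeding
    | _, _, .nil, hb => hb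
    | _, _, .cons h h', hb => by
      rw [List.forall_mem_cons] at hb ⊢
      exact ⟨h.isBleeding hb.1, h'.isBleeding hb.2⟩
    | _, _, .swap _ _ _, hb => by
      simp only [List.forall_mem_cons] at hb ⊢
      exact ⟨hb.2.1, hb.1, hb.2.2⟩
    | _, _, .trans h h', hb => h'.isBleeding (h.isBleeding hb)
end

/-- Unordered red/black trees: ordered trees up to the order of the children. -/
abbrev UnorderedTree : Type := Quotient RedTree.setoid

namespace UnorderedTree

/-- The multiset of labels. -/
def labels : UnorderedTree → Multiset ℕ :=
  Quotient.lift RedTree.labels fun _ _ h => RedIso.labels_eq h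

/-- The tree is a bleeding tree. -/
def IsBleeding : UnorderedTree → Prop :=
  Quotient.lift RedTree.IsBleeding fun _ _ h =>
    propext ⟨RedIso.isBleeding h, RedIso.isBleeding (RedIso.symm h)⟩

/-- The product of the weights of all black nodes. -/
def nodeWeight : UnorderedTree → Coeff :=
  Quotient.lift RedTree.nodeWeight fun _ _ h => RedIso.nodeWeight_eq h

/-- The orbit: all ordered trees (the red edge first at every red node) that represent `U`. -/
def orbit (U : UnorderedTree) : Set RedTree := {t | (⟦t⟧ : UnorderedTree) = U}

/-- `w(U)`: the number of ordered trees in the orbit, times the weights of all black nodes. -/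
def weight (U : UnorderedTree) : Coeff := (U.orbit.ncard : Coeff) * U.nodeWeight

end UnorderedTree

/-! ### Finiteness -/

theorem finite_lists {α : Type} (s : Set α) (hs : s.Finite) (n : ℕ) :
    {l : List α | l.length ≤ n ∧ ∀ a ∈ l, a ∈ s}.Finite := by
  have : Finite s := hs
  refine ((List.finite_length_le s n).image (List.map Subtype.val)).subset ?_
  rintro l ⟨h, h'⟩
  exact ⟨l.attach.map fun a => ⟨a.1, h' a.1 a.2⟩, by simpa using h, by simp⟩

theorem BlackTree.card_labels_pos (b : BlackTree) : 0 < Multiset.card b.labels := by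
  cases b; simp [BlackTree.labels]

theorem RedTree.card_labels_pos (t : RedTree) : 0 < Multiset.card t.labels := by
  cases t with
  | node b bs =>
    have := b.card_labels_pos
    simp only [RedTree.labels, Multiset.card_add]
    omega

theorem length_le_blackList (bs : List BlackTree) :
    bs.length ≤ Multiset.card (labelsBlackList bs) := by
  induction bs with
  | nil => simp
  | cons b bs ih =>
    have := b.card_labels_pos
    simp only [labelsBlackList, Multiset.card_add, List.length_cons]
    omega

theorem length_le_redList (ts : List RedTree) :
    ts.length ≤ Multiset.card (labelsRedList ts) := by
  induction ts with
  | nil => simp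
  | cons b bs ih =>
    have := b.card_labels_pos
    simp only [labelsRedList, Multiset.card_add, List.length_cons]
    omega

theorem labels_le_blackList {b : BlackTree} {bs : List BlackTree} (h : b ∈ bs) :
    b.labels ≤ labelsBlackList bs := by
  induction bs with
  | nil => simp at h
  | cons c bs ih =>
    rcases List.mem_cons.1 h with rfl | h
    · exact Multiset.le_add_right _ _
    · exact (ih h).trans (Multiset.le_add_left _ _)

theorem labels_le_redList {t : RedTree} {ts : List RedTree} (h : t ∈ ts) :
    t.labels ≤ labelsRedList ts := by
  induction ts with
  | nil => simp at h
  | cons c bs ih =>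
    rcases List.mem_cons.1 h with rfl | h
    · exact Multiset.le_add_right _ _
    · exact (ih h).trans (Multiset.le_add_left _ _)

theorem finite_ordered_aux (s : Multiset ℕ) (n : ℕ) :
    {b : BlackTree | Multiset.card b.labels ≤ n ∧ b.labels ⊆ s}.Finite ∧
      {t : RedTree | Multiset.card t.labels ≤ n ∧ t.labels ⊆ s}.Finite := by
  induction n with
  | zero =>
    constructor
    · refine Set.finite_empty.subset ?_
      rintro b ⟨h, -⟩
      exact absurd h (by simpa using b.card_labels_pos.ne')
    · refine Set.finite_empty.subset ?_
      rintro b ⟨h, -⟩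
      exact absurd h (by simpa using b.card_labels_pos.ne')
  | succ n ih =>
    have hS : {r : ℕ+ | (r : ℕ) ∈ s}.Finite :=
      (s.toFinset.finite_toSet.preimage PNat.coe_injective.injOn).subset fun r hr => by
        simpa using hr
    have hB : {b : BlackTree | Multiset.card b.labels ≤ n + 1 ∧ b.labels ⊆ s}.Finite := by
      refine ((hS.prod (finite_lists _ ih.2 n)).image fun q => BlackTree.node q.1 q.2).subset ?_
      rintro ⟨r, cs⟩ ⟨h, h'⟩
      simp only [BlackTree.labels, Multiset.card_add, Multiset.card_singleton] at h h'
      refine ⟨(r, cs), ⟨h' (by simp), ?_, fun t ht => ⟨?_, ?_⟩⟩, rfl⟩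
      · have := length_le_redList cs
        simp only
        omega
      · have : Multiset.card t.labels ≤ Multiset.card (labelsRedList cs) :=
          Multiset.card_le_card (labels_le_redList ht)
        omega
      · exact fun x hx => h' (Multiset.mem_add.2
          (Or.inr (Multiset.subset_of_le (labels_le_redList ht) hx)))
    refine ⟨hB, ?_⟩
    refine ((hB.prod (finite_lists _ hB (n + 1))).image fun q => RedTree.node q.1 q.2).subset ?_
    rintro ⟨b, bs⟩ ⟨h, h'⟩
    simp only [RedTree.labels, Multiset.card_add] at h h'
    refine ⟨(b, bs), ⟨⟨?_, ?_⟩, ?_, fun t ht => ⟨?_, ?_⟩⟩, rfl⟩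
    · simp only
      omega
    · exact fun x hx => h' (Multiset.mem_add.2 (Or.inl hx))
    · have := length_le_blackList bs
      simp only
      omega
    · have : Multiset.card t.labels ≤ Multiset.card (labelsBlackList bs) :=
          Multiset.card_le_card (labels_le_blackList ht)
      omega
    · exact fun x hx => h' (Multiset.mem_add.2
        (Or.inr (Multiset.subset_of_le (labels_le_blackList ht) hx)))

theorem finite_ordered (s : Multiset ℕ) : {t : RedTree | t.labels = s}.Finite := by
  refine (finite_ordered_aux s (Multiset.card s)).2.subset ?_
  rintro t rfl
  exact ⟨le_rfl, Multiset.Subset.refl _⟩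

/-- Orbits are finite, so that `Set.ncard` counts their elements. -/
theorem UnorderedTree.finite_orbit (U : UnorderedTree) : U.orbit.Finite := by
  refine (finite_ordered U.labels).subset ?_
  rintro t rfl
  rfl

theorem finite_bleeding {n : ℕ} (π : n.Partition) :
    {U : UnorderedTree | U.IsBleeding ∧ U.labels = π.parts}.Finite := by
  refine ((finite_ordered π.parts).image fun t => (⟦t⟧ : UnorderedTree)).subset ?_
  rintro U ⟨-, h⟩
  induction U using Quotient.inductionOn with
  | h t => exact ⟨t, h, rfl⟩

/-- `𝒰_π`: the finite set of bleeding trees whose labels, with repetitions, are the parts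
of `π`. -/
def bleedingTrees {n : ℕ} (π : n.Partition) : Finset UnorderedTree :=
  (finite_bleeding π).toFinset

end

/-!
Both sides are compared through a functional equation for `G`.

On the side of Smirnov trees, let `Gᵢ`, `a` and `c` be the generating functions of the trees with
root label `i`, `< i` and `> i`. Removing the root gives
`Gᵢ = xᵢ ((1 + λ̄ a + λ c) (1 + ρ a + ρ̄ c) + λ̄ ρ Gᵢ a + λ ρ̄ c Gᵢ)` (`rootSum_eq_some`), where the
last two terms are the trees in which a child of the root has label `i`. As `c = G - a - Gᵢ`, this is
a Möbius transformation taking `a` to `a + Gᵢ`, with fixed points that do not depend on `i`. The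
steps therefore telescope (`mobius_telescope`) to
`(1 + G u) ∏ (1 + xᵢ v) = (1 + G v) ∏ (1 + xᵢ u)`, where `u = ρ̄ + λ̄ + ρ̄ λ̄ G` and
`v = ρ + λ + ρ λ G`. With `∏ (1 + xᵢ t) = ∑ eₙ tⁿ`, dividing by `u - v` gives
(`functional_equation`)
`G = ∑ eₙ ∑_{0 ≤ i < n} uⁱ vⁿ⁻¹⁻ⁱ + G ∑ eₙ ∑_{0 < i < n} uⁱ vⁿ⁻ⁱ`.
By the binomial theorem the coefficients of `Gᵏ` in the two inner sums are `p̄(n,k)` and `p(n,k)`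
(`sum_pRed`, `sum_pBlack`).

On the side of bleeding trees, the generating function of ordered red/black trees satisfies the same
equation: the first sum accounts for the trees whose root has only the child joined by the red edge, the
second for a first child joined by a black edge (`redGF_eq`). The equation has only one solution (`eq_of_fixedPoint`),
so the two generating functions agree. Finally, trees that are not bleeding have weight `0`, and
summing over ordered trees amounts to summing over unordered trees with their orbit sizes
(`sum_weight_bleedingTrees`).

The telescoping product needs finitely many variables, and the algebra needs subtraction. So the
equations are truncated to `x₁, …, x_N` by the ring homomorphism `truncateVars`, and the
coefficients are extended to `ℤ`.
-/

noncomputable section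

/-! ### Sums of coefficientwise finite families of power series -/

section Families

open MvPowerSeries

variable {σ R A B : Type*} [CommSemiring R]

/-- A family of power series in which every monomial occurs in only finitely many members. -/
def CoeffFinite (f : A → MvPowerSeries σ R) : Prop :=
  ∀ m, (Function.support fun a => coeff m (f a)).Finite

/-- The coefficientwise sum of a family; it is meaningful when the family is `CoeffFinite`, and
otherwise the coefficients with infinitely many contributions are the junk value `0`. -/
def coeffSum (f : A → MvPowerSeries σ R) : MvPowerSeries σ R :=
  fun m => ∑ᶠ a, coeff m (f a)

theorem coeff_coeffSum (f : A → MvPowerSeries σ R) (m : σ →₀ ℕ) :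
    coeff m (coeffSum f) = ∑ᶠ a, coeff m (f a) := rfl

theorem CoeffFinite.of_support {f g : A → MvPowerSeries σ R} (hf : CoeffFinite f)
    (h : ∀ m a, coeff m (f a) = 0 → coeff m (g a) = 0) : CoeffFinite g :=
  fun m => (hf m).subset fun a ha ha' => ha (h m a ha')

theorem CoeffFinite.ite {f : A → MvPowerSeries σ R} (hf : CoeffFinite f) (p : A → Prop)
    [DecidablePred p] : CoeffFinite fun a => if p a then f a else 0 :=
  hf.of_support fun m a h => by split_ifs <;> simp [h]

theorem CoeffFinite.add {f g : A → MvPowerSeries σ R} (hf : CoeffFinite f)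
    (hg : CoeffFinite g) : CoeffFinite fun a => f a + g a := fun m =>
  ((hf m).union (hg m)).subset fun a ha => by
    by_contra h
    simp only [Set.mem_union, Function.mem_support, not_or, not_not] at h
    exact ha (by simp [h])

theorem CoeffFinite.const_mul {f : A → MvPowerSeries σ R} (hf : CoeffFinite f)
    (c : MvPowerSeries σ R) : CoeffFinite fun a => c * f a := by
  classical
  intro m
  refine (Set.Finite.biUnion (Finset.HasAntidiagonal.antidiagonal m).finite_toSet
    fun q _ => hf q.2).subset fun a ha => ?_
  obtain ⟨q, hq, hne⟩ := Finset.exists_ne_zero_of_sum_ne_zero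
    (by simpa [coeff_mul] using ha :
      ∑ q ∈ Finset.HasAntidiagonal.antidiagonal m, coeff q.1 c * coeff q.2 (f a) ≠ 0)
  exact Set.mem_biUnion (Finset.mem_coe.2 hq) (right_ne_zero_of_mul hne)

theorem CoeffFinite.mul {f : A → MvPowerSeries σ R} {g : B → MvPowerSeries σ R}
    (hf : CoeffFinite f) (hg : CoeffFinite g) :
    CoeffFinite fun p : A × B => f p.1 * g p.2 := by
  classical
  intro m
  refine (Set.Finite.biUnion (Finset.HasAntidiagonal.antidiagonal m).finite_toSet
    fun q _ => (hf q.1).prod (hg q.2)).subset fun a ha => ?_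
  obtain ⟨q, hq, hne⟩ := Finset.exists_ne_zero_of_sum_ne_zero
    (by simpa [coeff_mul] using ha :
      ∑ q ∈ Finset.HasAntidiagonal.antidiagonal m, coeff q.1 (f a.1) * coeff q.2 (g a.2) ≠ 0)
  exact Set.mem_biUnion (Finset.mem_coe.2 hq)
    ⟨left_ne_zero_of_mul hne, right_ne_zero_of_mul hne⟩

theorem coeffSum_add {f g : A → MvPowerSeries σ R} (hf : CoeffFinite f) (hg : CoeffFinite g) :
    (coeffSum fun a => f a + g a) = coeffSum f + coeffSum g := by
  ext m
  simp only [coeff_coeffSum, map_add]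
  exact finsum_add_distrib (hf m) (hg m)

theorem coeffSum_finset_sum {ι : Type*} (s : Finset ι) {f : ι → A → MvPowerSeries σ R}
    (hf : ∀ i ∈ s, CoeffFinite (f i)) :
    (coeffSum fun a => ∑ i ∈ s, f i a) = ∑ i ∈ s, coeffSum (f i) := by
  ext m
  simp only [coeff_coeffSum, map_sum]
  exact finsum_sum_comm s (fun a i => coeff m (f i a)) fun i hi => hf i hi m

theorem coeffSum_mul {f : A → MvPowerSeries σ R} {g : B → MvPowerSeries σ R}
    (hf : CoeffFinite f) (hg : CoeffFinite g) :
    (coeffSum fun p : A × B => f p.1 * g p.2) = coeffSum f * coeffSum g := by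
  classical
  ext m
  have hfin : ∀ q : (σ →₀ ℕ) × (σ →₀ ℕ), (Function.support fun p : A × B =>
      coeff q.1 (f p.1) * coeff q.2 (g p.2)).Finite := fun q =>
    ((hf q.1).prod (hg q.2)).subset fun p hp =>
      ⟨left_ne_zero_of_mul hp, right_ne_zero_of_mul hp⟩
  simp only [coeff_coeffSum, coeff_mul]
  rw [finsum_sum_comm _ _ fun q _ => hfin q]
  refine Finset.sum_congr rfl fun q _ => ?_
  rw [finsum_curry _ (hfin q), finsum_mul' _ _ (hf q.1)]
  exact finsum_congr fun a => (mul_finsum' _ (coeff q.1 (f a)) (hg q.2)).symm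

theorem coeffSum_const_mul {f : A → MvPowerSeries σ R} (hf : CoeffFinite f)
    (c : MvPowerSeries σ R) : (coeffSum fun a => c * f a) = c * coeffSum f := by
  classical
  ext m
  have hfin : ∀ q : (σ →₀ ℕ) × (σ →₀ ℕ), (Function.support fun a =>
      coeff q.1 c * coeff q.2 (f a)).Finite := fun q =>
    (hf q.2).subset fun p hp => right_ne_zero_of_mul hp
  simp only [coeff_coeffSum, coeff_mul]
  rw [finsum_sum_comm _ _ fun q _ => hfin q]
  exact Finset.sum_congr rfl fun q _ => (mul_finsum' _ _ (hf q.2)).symm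

/-- Reindexing along an injection whose range contains all nonzero members. It is applied to the
constructors of inductive types of trees. -/
theorem coeffSum_comp_injective (f : A → MvPowerSeries σ R) {g : B → A}
    (hg : Function.Injective g) (hfg : ∀ a, a ∉ Set.range g → f a = 0) :
    (coeffSum fun b => f (g b)) = coeffSum f := by
  ext m
  simp only [coeff_coeffSum]
  classical
  rw [← finsum_mem_range (f := fun a => coeff m (f a)) hg]
  refine finsum_congr fun a => ?_
  by_cases ha : a ∈ Set.range g
  · exact finsum_eq_if.trans (if_pos ha)
  · simp [ha, hfg a ha]

theorem coeffSum_ite_eq (f : A → MvPowerSeries σ R) (a₀ : A) [DecidablePred (· = a₀)] :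
    (coeffSum fun a => if a = a₀ then f a else 0) = f a₀ := by
  ext m
  rw [coeff_coeffSum, finsum_eq_single _ a₀ fun a ha => by simp [ha], if_pos rfl]

/-- A sum over all lists, split into the empty list and the lists with a head and a tail. -/
theorem coeffSum_list {f : List A → MvPowerSeries σ R} (hf : CoeffFinite f) :
    coeffSum f = f [] + coeffSum fun p : A × List A => f (p.1 :: p.2) := by
  classical
  have h1 : f = fun l => (if l = [] then f l else 0) + if l ≠ [] then f l else 0 := by
    funext l
    by_cases h : l = [] <;> simp [h]
  rw [show coeffSum f = _ from congrArg coeffSum h1, coeffSum_add (hf.ite _) (hf.ite _),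
    coeffSum_ite_eq]
  congr 1
  refine (coeffSum_comp_injective (fun l => if l ≠ [] then f l else 0)
    (g := fun p : A × List A => p.1 :: p.2) (fun p q h => ?_) fun l hl => ?_).symm.trans ?_
  · simpa [Prod.ext_iff] using h
  · cases l with
    | nil => simp
    | cons a l => exact absurd ⟨(a, l), rfl⟩ hl
  · simp

end Families

/-! ### Setting all but some variables to zero -/

section Truncation

open MvPowerSeries

variable {σ : Type*}

open Classical in
/-- The ring endomorphism of power series that sets all variables outside `S` to `0`. -/
def truncateVars (R : Type*) [CommSemiring R] (S : Set σ) :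
    MvPowerSeries σ R →+* MvPowerSeries σ R where
  toFun f m := if ∀ a, m a ≠ 0 → a ∈ S then coeff m f else 0
  map_zero' := by
    ext m
    change (if _ then coeff m (0 : MvPowerSeries σ R) else 0) = coeff m 0
    simp
  map_one' := by
    ext m
    change (if _ then coeff m (1 : MvPowerSeries σ R) else 0) = _
    rw [coeff_one]
    split_ifs with h1 h2 h3 <;> simp_all
  map_add' f g := by
    ext m
    change (if _ then coeff m (f + g) else 0) =
      (if _ then coeff m f else 0) + (if _ then coeff m g else 0)
    split_ifs <;> simp
  map_mul' f g := by
    ext m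
    refine Eq.trans ?_ (coeff_mul ..).symm
    change (if _ then coeff m (f * g) else 0) = ∑ p ∈ Finset.HasAntidiagonal.antidiagonal m,
      (if ∀ a, p.1 a ≠ 0 → a ∈ S then coeff p.1 f else 0) *
        (if ∀ a, p.2 a ≠ 0 → a ∈ S then coeff p.2 g else 0)
    split_ifs with h
    · rw [coeff_mul]
      refine Finset.sum_congr rfl fun p hp => ?_
      rw [Finset.HasAntidiagonal.mem_antidiagonal] at hp
      rw [if_pos, if_pos]
      · exact fun a ha => h a (by rw [← hp, Finsupp.add_apply]; omega)
      · exact fun a ha => h a (by rw [← hp, Finsupp.add_apply]; omega)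
    · refine (Finset.sum_eq_zero fun p hp => ?_).symm
      rw [Finset.HasAntidiagonal.mem_antidiagonal] at hp
      by_cases h1 : ∀ a, p.1 a ≠ 0 → a ∈ S
      · rw [if_pos h1, if_neg fun h2 => h fun a ha => ?_, mul_zero]
        by_cases ha1 : p.1 a = 0
        · exact h2 a (by rw [← hp, Finsupp.add_apply] at ha; omega)
        · exact h1 a ha1
      · rw [if_neg h1, zero_mul]

variable {R : Type*} [CommSemiring R]

open Classical in
theorem coeff_truncateVars (S : Set σ) (f : MvPowerSeries σ R) (m : σ →₀ ℕ) :
    coeff m (truncateVars R S f) = if ∀ a, m a ≠ 0 → a ∈ S then coeff m f else 0 := rfl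

theorem coeff_truncateVars_of_forall {S : Set σ} (f : MvPowerSeries σ R) {m : σ →₀ ℕ}
    (h : ∀ a, m a ≠ 0 → a ∈ S) : coeff m (truncateVars R S f) = coeff m f := by
  rw [coeff_truncateVars, if_pos h]

theorem constantCoeff_truncateVars (S : Set σ) (f : MvPowerSeries σ R) :
    constantCoeff (truncateVars R S f) = constantCoeff f := by
  rw [← coeff_zero_eq_constantCoeff_apply, ← coeff_zero_eq_constantCoeff_apply,
    coeff_truncateVars_of_forall _ (by simp)]

theorem truncateVars_C (S : Set σ) (c : R) : truncateVars R S (C c) = C c := by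
  classical
  ext m
  rw [coeff_truncateVars, coeff_C]
  split_ifs with h1 h2 h2 <;> simp_all

theorem truncateVars_X {S : Set σ} {a : σ} (ha : a ∈ S) : truncateVars R S (X a) = X a := by
  classical
  ext m
  rw [coeff_truncateVars, coeff_X]
  split_ifs with h1 h2 h2 <;> try rfl
  exact absurd (fun b hb => by
    rw [h2, Finsupp.single_apply] at hb
    split_ifs at hb with h
    · exact h ▸ ha
    · simp at hb) h1

theorem CoeffFinite.truncateVars {A : Type*} {f : A → MvPowerSeries σ R} (hf : CoeffFinite f)
    (S : Set σ) : CoeffFinite fun a => truncateVars R S (f a) :=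
  hf.of_support fun m a h => by classical rw [coeff_truncateVars, h, ite_self]

theorem truncateVars_coeffSum {A : Type*} (f : A → MvPowerSeries σ R) (S : Set σ) :
    truncateVars R S (coeffSum f) = coeffSum fun a => truncateVars R S (f a) := by
  classical
  ext m
  simp only [coeff_truncateVars, coeff_coeffSum]
  split_ifs <;> simp

end Truncation

/-! ### Smirnov trees by the label of the root -/

section Smirnov

open MvPowerSeries Classical

/-- The contribution of a tree satisfying the Smirnov condition, which may be empty, to the
generating function; the contribution is `0` if the condition fails. -/
def smirnovTerm (T : BinaryTree ℕ+) : Series :=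
  if SmirnovCond T then monomial (content T) (edgeWeight T) else 0

theorem coeffFinite_smirnovTerm : CoeffFinite smirnovTerm := by
  intro m
  refine (finite_trees_aux m.support m.support.finite_toSet m.degree).subset fun T hT => ?_
  have h : m = content T := by
    by_contra h
    apply hT
    change coeff m (smirnovTerm T) = 0
    rw [smirnovTerm]
    split_ifs
    · rw [coeff_monomial, if_neg h]
    · rfl
  subst h
  exact ⟨(degree_content T).ge, fun a ha => by simpa using ha⟩

/-- The contribution of a tree whose root label satisfies `p`, where the label `none` stands for the
empty tree. -/
def rootTerm (p : Option ℕ+ → Prop) (T : BinaryTree ℕ+) : Series :=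
  if p (rootLabel T) then smirnovTerm T else 0

/-- The generating function of the trees satisfying the Smirnov condition whose root label
satisfies `p`. -/
def rootSum (p : Option ℕ+ → Prop) : Series := coeffSum (rootTerm p)

theorem coeffFinite_rootTerm (p : Option ℕ+ → Prop) : CoeffFinite (rootTerm p) :=
  coeffFinite_smirnovTerm.ite _

theorem rootSum_none : rootSum (· = none) = 1 := by
  have h : ∀ T : BinaryTree ℕ+, rootLabel T = none ↔ T = .nil := by
    rintro (_ | _) <;> simp [rootLabel]
  rw [rootSum, show rootTerm (· = none) = fun T => if T = .nil then smirnovTerm T else 0 from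
    funext fun T => by simp only [rootTerm, h], coeffSum_ite_eq]
  simp [smirnovTerm, SmirnovCond, content, edgeWeight]

theorem rootSum_or {p q : Option ℕ+ → Prop} (h : ∀ o, p o → ¬ q o) :
    rootSum (fun o => p o ∨ q o) = rootSum p + rootSum q := by
  rw [rootSum, rootSum, rootSum,
    ← coeffSum_add (coeffFinite_rootTerm p) (coeffFinite_rootTerm q)]
  congr 1
  funext T
  by_cases hp : p (rootLabel T) <;> by_cases hq : q (rootLabel T) <;> simp [rootTerm, hp, hq]
  exact absurd hq (h _ hp)

theorem smirnovGF_eq_rootSum : smirnovGF = rootSum (· ≠ none) := by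
  ext1 m
  change ∑ T ∈ (finite_smirnov m).toFinset, edgeWeight T = _
  rw [rootSum, coeff_coeffSum, ← finsum_mem_coe_finset]
  refine finsum_congr fun T => ?_
  have h : rootLabel T ≠ none ↔ T ≠ .nil := by cases T <;> simp [rootLabel]
  by_cases hT : T = .nil
  · simp [hT, IsSmirnov, rootLabel, rootTerm]
  by_cases hc : SmirnovCond T
  · by_cases hm : content T = m
    · simp [hm, rootTerm, smirnovTerm, IsSmirnov, h, hT, hc]
    · simp [hm, rootTerm, smirnovTerm, IsSmirnov, h, hT, hc, coeff_monomial, Ne.symm hm]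
  · simp [rootTerm, smirnovTerm, IsSmirnov, hc]

/-- There is a root, and its label is less than `i`. -/
def RootLT (i : ℕ+) (o : Option ℕ+) : Prop := ∃ c, o = some c ∧ c < i

/-- There is a root, and its label is greater than `i`. -/
def RootGT (i : ℕ+) (o : Option ℕ+) : Prop := ∃ c, o = some c ∧ i < c

theorem smirnovTerm_node (i : ℕ+) (l r : BinaryTree ℕ+) :
    smirnovTerm (.node i l r) = X i * (if
      (rootLabel l = some i → ∃ c, rootLabel r = some c ∧ c < i) ∧
      (rootLabel r = some i → ∃ c, rootLabel l = some c ∧ i < c) then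
        C (leftEdgeWeight i (rootLabel l) * rightEdgeWeight i (rootLabel r)) else 0) *
      (smirnovTerm l * smirnovTerm r) := by
  simp only [smirnovTerm, SmirnovCond]
  by_cases hl : SmirnovCond l <;> by_cases hr : SmirnovCond r <;>
    simp only [hl, hr, and_true, and_false, if_true, if_false, mul_zero, zero_mul]
  rw [mul_ite, ite_mul, mul_zero, zero_mul]
  refine if_congr Iff.rfl ?_ rfl
  rw [X, ← monomial_zero_eq_C_apply, monomial_mul_monomial, monomial_mul_monomial,
    monomial_mul_monomial]
  simp only [content, edgeWeight, add_zero, one_mul, mul_assoc, add_assoc]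

/-- Decomposition of the contribution of a tree at its root, labelled `i`. In the first summand no
child of the root has label `i`; in the second the left child, and in the third the right child,
has label `i`, and the Smirnov condition then determines on which side of `i` the label of the
other child lies. -/
theorem smirnovTerm_node_eq (i : ℕ+) (l r : BinaryTree ℕ+) :
    smirnovTerm (.node i l r) = X i * (
      (rootTerm (· = none) l + (C Coeff.lb * rootTerm (RootLT i) l +
        C Coeff.la * rootTerm (RootGT i) l)) *
      (rootTerm (· = none) r + (C Coeff.ρ * rootTerm (RootLT i) r +
        C Coeff.ρb * rootTerm (RootGT i) r)) +
      (C (Coeff.lb * Coeff.ρ) * (rootTerm (· = some i) l * rootTerm (RootLT i) r) +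
      C (Coeff.la * Coeff.ρb) * (rootTerm (RootGT i) l * rootTerm (· = some i) r))) := by
  rw [smirnovTerm_node]
  simp only [rootTerm, RootLT, RootGT]
  rcases rootLabel l with _ | a <;> rcases rootLabel r with _ | b
  · simp [leftEdgeWeight, rightEdgeWeight]
  · rcases lt_trichotomy b i with hb | rfl | hb
    · simp [leftEdgeWeight, rightEdgeWeight, hb, hb.not_ge, hb.ne, hb.not_gt]; ring
    · simp
    · simp [leftEdgeWeight, rightEdgeWeight, hb, hb.le, hb.ne', hb.not_gt]; ring
  · rcases lt_trichotomy a i with ha | rfl | ha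
    · simp [leftEdgeWeight, rightEdgeWeight, ha, ha.le, ha.ne, ha.not_gt]; ring
    · simp
    · simp [leftEdgeWeight, rightEdgeWeight, ha, ha.not_ge, ha.ne', ha.not_gt]; ring
  · rcases lt_trichotomy a i with ha | ha | ha <;> rcases lt_trichotomy b i with hb | hb | hb <;>
    simp [leftEdgeWeight, rightEdgeWeight, *, LT.lt.le, LT.lt.not_ge, LT.lt.ne, LT.lt.ne',
      LT.lt.not_gt] <;> ring

/-- The recursion for the trees with root label `i`. -/
theorem rootSum_eq_some (i : ℕ+) :
    rootSum (· = some i) = X i * (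
      (1 + (C Coeff.lb * rootSum (RootLT i) + C Coeff.la * rootSum (RootGT i))) *
      (1 + (C Coeff.ρ * rootSum (RootLT i) + C Coeff.ρb * rootSum (RootGT i))) +
      (C (Coeff.lb * Coeff.ρ) * (rootSum (· = some i) * rootSum (RootLT i)) +
      C (Coeff.la * Coeff.ρb) * (rootSum (RootGT i) * rootSum (· = some i)))) := by
  have fin := coeffFinite_rootTerm
  have hinj : Function.Injective
      fun p : BinaryTree ℕ+ × BinaryTree ℕ+ => BinaryTree.node i p.1 p.2 := fun p q h => by
    simpa [Prod.ext_iff] using h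
  have hlin : ∀ c d : Coeff,
      CoeffFinite (fun T => rootTerm (· = none) T +
        (C c * rootTerm (RootLT i) T + C d * rootTerm (RootGT i) T)) ∧
      coeffSum (fun T => rootTerm (· = none) T +
        (C c * rootTerm (RootLT i) T + C d * rootTerm (RootGT i) T)) =
      1 + (C c * rootSum (RootLT i) + C d * rootSum (RootGT i)) := fun c d => by
    refine ⟨(fin _).add (((fin _).const_mul _).add ((fin _).const_mul _)), ?_⟩
    rw [coeffSum_add (fin _) (((fin _).const_mul _).add ((fin _).const_mul _)),
      coeffSum_add ((fin _).const_mul _) ((fin _).const_mul _), coeffSum_const_mul (fin _),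
      coeffSum_const_mul (fin _), ← rootSum_none]
    rfl
  have h1 := (hlin Coeff.lb Coeff.la).1.mul (hlin Coeff.ρ Coeff.ρb).1
  have h2 := ((fin (· = some i)).mul (fin (RootLT i))).const_mul (C (Coeff.lb * Coeff.ρ))
  have h3 := ((fin (RootGT i)).mul (fin (· = some i))).const_mul (C (Coeff.la * Coeff.ρb))
  conv_lhs => rw [rootSum, ← coeffSum_comp_injective _ hinj (fun T hT => by
    rcases T with _ | ⟨j, l, r⟩
    · simp [rootTerm, rootLabel]
    · by_cases h : j = i
      · exact absurd ⟨(l, r), by rw [h]⟩ hT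
      · simp [rootTerm, rootLabel, h])]
  simp only [rootTerm, rootLabel, if_true]
  simp only [smirnovTerm_node_eq]
  rw [coeffSum_const_mul (h1.add (h2.add h3)), coeffSum_add h1 (h2.add h3), coeffSum_add h2 h3,
    coeffSum_mul (hlin _ _).1 (hlin _ _).1, (hlin _ _).2, (hlin _ _).2,
    coeffSum_const_mul ((fin _).mul (fin _)), coeffSum_const_mul ((fin _).mul (fin _)),
    coeffSum_mul (fin _) (fin _), coeffSum_mul (fin _) (fin _)]
  rfl

theorem rootSum_succ (n : ℕ) : rootSum (RootLT (n + 1).succPNat) =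
    rootSum (RootLT n.succPNat) + rootSum (· = some n.succPNat) := by
  rw [← rootSum_or]
  · congr 1
    funext o
    rcases o with _ | a
    · simp [RootLT]
    · simp only [RootLT, Option.some.injEq, exists_eq_left', eq_iff_iff]
      simp only [← PNat.coe_lt_coe, ← PNat.coe_inj, Nat.succPNat_coe]
      omega
  · rintro o ⟨c, rfl, hc⟩ h
    exact hc.ne (Option.some.inj h)

theorem smirnovGF_eq (i : ℕ+) :
    smirnovGF = rootSum (RootLT i) + (rootSum (· = some i) + rootSum (RootGT i)) := by
  rw [smirnovGF_eq_rootSum, ← rootSum_or, ← rootSum_or]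
  · congr 1
    funext o
    rcases o with _ | a
    · simp [RootLT, RootGT]
    · simpa [RootLT, RootGT] using lt_trichotomy a i
  · rintro o ⟨c, rfl, hc⟩ (h | ⟨d, h, hd⟩)
    · exact hc.ne (Option.some.inj h)
    · exact lt_asymm hc (Option.some.inj h ▸ hd)
  · rintro o rfl ⟨d, h, hd⟩
    exact hd.ne (Option.some.inj h)

theorem rootSum_zero : rootSum (RootLT (Nat.succPNat 0)) = 0 := by
  ext1 m
  rw [rootSum, coeff_coeffSum, map_zero]
  refine finsum_eq_zero_of_forall_eq_zero fun T => ?_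
  rw [rootTerm, if_neg, map_zero]
  rintro ⟨c, -, hc⟩
  exact not_lt_one hc

theorem constantCoeff_rootSum {p : Option ℕ+ → Prop} (hp : ¬ p none) :
    constantCoeff (rootSum p) = 0 := by
  rw [← coeff_zero_eq_constantCoeff_apply, rootSum, coeff_coeffSum]
  refine finsum_eq_zero_of_forall_eq_zero fun T => ?_
  rw [rootTerm]
  split_ifs with h
  · rw [smirnovTerm]
    split_ifs
    · rcases T with _ | ⟨i, l, r⟩
      · exact absurd h hp
      · rw [coeff_monomial, if_neg]
        intro h0
        have := congrArg (fun m => m i) h0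
        simp [content] at this
        omega
    · simp
  · simp

/-- After truncation to `x₁, …, x_N` all roots have label at most `N`. -/
theorem truncateVars_rootSum (N : ℕ) :
    truncateVars Coeff {i : ℕ+ | (i : ℕ) ≤ N} (rootSum (RootLT N.succPNat)) =
      truncateVars Coeff {i : ℕ+ | (i : ℕ) ≤ N} smirnovGF := by
  ext1 m
  rw [coeff_truncateVars, coeff_truncateVars]
  split_ifs with hm
  · rw [smirnovGF_eq_rootSum, rootSum, rootSum, coeff_coeffSum, coeff_coeffSum]
    refine finsum_congr fun T => ?_
    rcases T with _ | ⟨i, l, r⟩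
    · simp [rootTerm, rootLabel, RootLT]
    · by_cases hi : i < N.succPNat
      · simp [rootTerm, rootLabel, RootLT, hi]
      · simp only [rootTerm, rootLabel, RootLT, Option.some.injEq, exists_eq_left', hi, if_false,
          ne_eq, reduceCtorEq, not_false_eq_true, if_true, map_zero, smirnovTerm]
        split_ifs
        · rw [coeff_monomial, if_neg]
          rintro rfl
          refine hi ?_
          have := hm i (by simp [content])
          rw [← PNat.coe_lt_coe, Nat.succPNat_coe]
          exact Nat.lt_succ_of_le this
        · simp
  · rfl
end Smirnov

/-! ### The functional equation as pure algebra -/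

section Algebra

/-- Let `a n` and `c n` be the generating functions of the trees with root label `≤ n` and `> n + 1`,
and `g n` the one with root label `n + 1`. The recursion for `g n` relates `a n` and `a (n + 1)` by a
Möbius transformation, whose fixed points do not depend on `n`: they are the zeros of
`L(a) = 1 + λ̄ a + λ (G - a)` and `R(a) = 1 + ρ a + ρ̄ (G - a)`. Hence `L(a) / R(a)` is multiplied by
`(1 + x u) / (1 + x v)` at each step, where `u = ρ̄ + λ̄ + ρ̄ λ̄ G` and `v = ρ + λ + ρ λ G`. Going from
`a 0 = 0` to `a N = G` gives the identity, as `(1 + ρ̄ G) (1 + λ̄ G) = 1 + G u` and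
`(1 + ρ G) (1 + λ G) = 1 + G v`. -/
theorem mobius_telescope {S : Type*} [CommRing S] [NoZeroDivisors S] (lb la rb ρ G : S)
    (x a g c : ℕ → S) (N : ℕ) (h0 : a 0 = 0) (hN : a N = G)
    (hsucc : ∀ n, a (n + 1) = a n + g n) (hG : ∀ n, G = a n + (g n + c n))
    (hg : ∀ n, g n = x n * ((1 + (lb * a n + la * c n)) * (1 + (ρ * a n + rb * c n)) +
      (lb * ρ * (g n * a n) + la * rb * (c n * g n))))
    (hR : ∀ n, 1 + ρ * a n + rb * (G - a n) ≠ 0) :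
    (1 + G * (rb + lb + rb * lb * G)) * ∏ n ∈ Finset.range N, (1 + x n * (ρ + la + ρ * la * G)) =
    (1 + G * (ρ + la + ρ * la * G)) *
      ∏ n ∈ Finset.range N, (1 + x n * (rb + lb + rb * lb * G)) := by
  have key : ∀ m, (1 + lb * a m + la * (G - a m)) * (1 + rb * G) *
        ∏ n ∈ Finset.range m, (1 + x n * (ρ + la + ρ * la * G)) =
      (1 + la * G) * (1 + ρ * a m + rb * (G - a m)) *
        ∏ n ∈ Finset.range m, (1 + x n * (rb + lb + rb * lb * G)) := by
    intro m
    induction m with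
    | zero => simp [h0]
    | succ m ih =>
      rw [Finset.prod_range_succ, Finset.prod_range_succ]
      have step : (1 + lb * a (m + 1) + la * (G - a (m + 1))) *
            (1 + ρ * a m + rb * (G - a m)) * (1 + x m * (ρ + la + ρ * la * G)) =
          (1 + lb * a m + la * (G - a m)) *
            (1 + ρ * a (m + 1) + rb * (G - a (m + 1))) *
            (1 + x m * (rb + lb + rb * lb * G)) := by
        have hc : c m = G - a m - g m := by linear_combination -(hG m)
        have := hg m
        rw [hc] at this
        rw [hsucc]
        linear_combination (rb + lb + rb * lb * G - (ρ + la + ρ * la * G)) * this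
      refine mul_left_cancel₀ (hR m) ?_
      linear_combination ((1 + rb * G) *
        ∏ n ∈ Finset.range m, (1 + x n * (ρ + la + ρ * la * G))) * step +
        (1 + ρ * a (m + 1) + rb * (G - a (m + 1))) * (1 + x m * (rb + lb + rb * lb * G)) * ih
  have := key N
  rw [hN] at this
  linear_combination this

/-- Dividing the product identity by `u - v` turns it into a fixed-point equation for `G` in which
only positive coefficients occur. -/
theorem functional_equation {S : Type*} [CommRing S] [NoZeroDivisors S] {u v G : S} (huv : u ≠ v)
    (e : ℕ → S) (N : ℕ)
    (h : (1 + G * u) * (1 + ∑ n ∈ Finset.range N, e (n + 1) * v ^ (n + 1)) =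
      (1 + G * v) * (1 + ∑ n ∈ Finset.range N, e (n + 1) * u ^ (n + 1))) :
    G = ∑ n ∈ Finset.range N, e (n + 1) * (∑ i ∈ Finset.range (n + 1), u ^ i * v ^ (n - i) +
      G * ∑ i ∈ Finset.Icc 1 n, u ^ i * v ^ (n + 1 - i)) := by
  refine mul_left_cancel₀ (sub_ne_zero.2 huv) ?_
  -- The inner sums are `(u ^ (n + 1) - v ^ (n + 1)) / (u - v)` and
  -- `u v (u ^ n - v ^ n) / (u - v)`.
  have h1 : ∀ n, (u - v) * ∑ i ∈ Finset.range (n + 1), u ^ i * v ^ (n - i) =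
      u ^ (n + 1) - v ^ (n + 1) := fun n => by
    rw [mul_comm]
    exact geom_sum₂_mul u v (n + 1)
  have h2 : ∀ n, (u - v) * ∑ i ∈ Finset.Icc 1 n, u ^ i * v ^ (n + 1 - i) =
      u ^ (n + 1) * v - u * v ^ (n + 1) := fun n => by
    have hr : ∑ i ∈ Finset.Icc 1 n, u ^ i * v ^ (n + 1 - i) =
        u * v * ∑ i ∈ Finset.range n, u ^ i * v ^ (n - 1 - i) := by
      rw [Finset.range_eq_Ico, Finset.mul_sum, ← Finset.Ico_add_one_right_eq_Icc,
        ← Finset.sum_Ico_add' _ 0 n 1]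
      refine Finset.sum_congr rfl fun i hi => ?_
      rw [Finset.mem_Ico] at hi
      rw [show n + 1 - (i + 1) = n - 1 - i + 1 by omega]
      ring
    rw [hr]
    linear_combination u * v * geom_sum₂_mul u v n
  have h3 : (u - v) * ∑ n ∈ Finset.range N, e (n + 1) *
      (∑ i ∈ Finset.range (n + 1), u ^ i * v ^ (n - i) +
        G * ∑ i ∈ Finset.Icc 1 n, u ^ i * v ^ (n + 1 - i)) =
      (1 + G * v) * ∑ n ∈ Finset.range N, e (n + 1) * u ^ (n + 1) -
      (1 + G * u) * ∑ n ∈ Finset.range N, e (n + 1) * v ^ (n + 1) := by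
    rw [Finset.mul_sum, Finset.mul_sum, Finset.mul_sum, ← Finset.sum_sub_distrib]
    refine Finset.sum_congr rfl fun n _ => ?_
    linear_combination e (n + 1) * h1 n + G * e (n + 1) * h2 n
  rw [h3]
  linear_combination h

/-- A fixed-point equation `a = ∑ eₙ Fₙ(a)`, where the `eₙ` have no constant term, has at most one
solution: if `a` and `b` are solutions, then `a - b = (a - b) w` for a power series `w` without
constant term. -/
theorem eq_of_fixedPoint {σ K : Type*} [CommRing K] [IsDomain K] {ι : Type*} (s : Finset ι)
    (e : ι → MvPowerSeries σ K) (F : ι → Polynomial (MvPowerSeries σ K))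
    (he : ∀ n ∈ s, MvPowerSeries.constantCoeff (e n) = 0) {a b : MvPowerSeries σ K}
    (ha : a = ∑ n ∈ s, e n * (F n).eval a) (hb : b = ∑ n ∈ s, e n * (F n).eval b) : a = b := by
  choose w hw using fun n => Polynomial.sub_dvd_eval_sub a b (F n)
  have h : (a - b) * (1 - ∑ n ∈ s, e n * w n) = 0 := by
    have : a - b = (a - b) * ∑ n ∈ s, e n * w n := by
      conv_lhs => rw [ha, hb]
      rw [← Finset.sum_sub_distrib, Finset.mul_sum]
      refine Finset.sum_congr rfl fun n _ => ?_
      rw [← mul_sub, hw]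
      ring
    linear_combination this
  rcases mul_eq_zero.1 h with h | h
  · exact sub_eq_zero.1 h
  · have := congrArg MvPowerSeries.constantCoeff h
    rw [map_sub, map_sum, Finset.sum_eq_zero fun n hn => by rw [map_mul, he n hn, zero_mul]] at this
    simp at this

/-- The weights `weightTerm n k i` are the coefficients of the powers of `X` in
`(ρ̄ + λ̄ + ρ̄ λ̄ X) ^ i (ρ + λ + ρ λ X) ^ (n - i)`. -/
theorem sum_weightTerm {S : Type*} [CommSemiring S] (f : Coeff →+* S) (X : S) {n i M : ℕ}
    (hi : i ≤ n) (hM : n < M) :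
    ∑ k ∈ Finset.range M, f (weightTerm n k i) * X ^ k =
      (f (Coeff.ρb + Coeff.lb) + f (Coeff.ρb * Coeff.lb) * X) ^ i *
      (f (Coeff.ρ + Coeff.la) + f (Coeff.ρ * Coeff.la) * X) ^ (n - i) := by
  rw [add_pow, add_pow, Finset.sum_mul]
  simp only [weightTerm, map_sum, Finset.sum_mul]
  rw [Finset.sum_comm]
  refine Finset.sum_congr rfl fun j hj => ?_
  rw [Finset.mem_range] at hj
  rw [Finset.mul_sum]
  -- The term `l` of the second binomial expansion contributes to the exponent `k = n - j - l`.
  refine (Finset.sum_of_injOn (fun l => n - j - l) ?_ ?_ ?_ ?_).symm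
  · intro l hl l' hl' h
    simp only [Finset.coe_range, Set.mem_Iio] at hl hl' h
    omega
  · intro l hl
    simp only [Finset.coe_range, Set.mem_Iio] at hl ⊢
    omega
  · intro k hk hk'
    split_ifs with hkj
    · rw [Nat.choose_eq_zero_of_lt (n := n - i)]
      · simp
      · by_contra hlt
        refine hk' ⟨n - (k + j), ?_, ?_⟩
        · simp only [Finset.coe_range, Set.mem_Iio]
          omega
        · simp only
          omega
    · simp
  · intro l hl
    rw [Finset.mem_range] at hl
    rw [if_pos (by omega), show n - (n - j - l + j) = l by omega,
      show n - j - l + j - i = n - i - l by omega]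
    have hx : X ^ (n - j - l) = X ^ (i - j) * X ^ (n - i - l) := by
      rw [← pow_add]
      congr 1
      omega
    rw [hx]
    simp only [map_mul, map_pow, map_natCast, Nat.cast_mul, map_add, mul_pow]
    ring

theorem sum_pRed {S : Type*} [CommSemiring S] (f : Coeff →+* S) (X : S) (n : ℕ) :
    ∑ k ∈ Finset.range (n + 2), f (pRed (n + 1) k) * X ^ k =
      ∑ i ∈ Finset.range (n + 1),
      (f (Coeff.ρb + Coeff.lb) + f (Coeff.ρb * Coeff.lb) * X) ^ i *
      (f (Coeff.ρ + Coeff.la) + f (Coeff.ρ * Coeff.la) * X) ^ (n - i) := by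
  simp only [pRed, map_sum, Finset.sum_mul]
  rw [Finset.sum_comm]
  refine Finset.sum_congr rfl fun i hi => ?_
  rw [Finset.mem_range] at hi
  exact sum_weightTerm f X (by omega) (by omega)

theorem sum_pBlack {S : Type*} [CommSemiring S] (f : Coeff →+* S) (X : S) (n : ℕ) :
    ∑ k ∈ Finset.range (n + 2), f (pBlack (n + 1) k) * X ^ k =
      ∑ i ∈ Finset.Icc 1 n,
      (f (Coeff.ρb + Coeff.lb) + f (Coeff.ρb * Coeff.lb) * X) ^ i *
      (f (Coeff.ρ + Coeff.la) + f (Coeff.ρ * Coeff.la) * X) ^ (n + 1 - i) := by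
  simp only [pBlack, map_sum, Finset.sum_mul]
  rw [Finset.sum_comm]
  refine Finset.sum_congr rfl fun i hi => ?_
  rw [Finset.mem_Icc] at hi
  exact sum_weightTerm f X (by omega) (by omega)

end Algebra

/-! ### Elementary symmetric functions -/

section ElemSymm

open MvPowerSeries

theorem truncateVars_elemSymm (s : Finset ℕ+) (n : ℕ) :
    truncateVars Coeff (s : Set ℕ+) (elemSymm n) =
      ∑ t ∈ s.powersetCard n, ∏ a ∈ t, X a := by
  classical
  have hprod : ∀ t : Finset ℕ+, (∏ a ∈ t, X a : Series) =
      monomial (∑ a ∈ t, Finsupp.single a 1) 1 := fun t => by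
    induction t using Finset.induction_on with
    | empty => simp
    | insert a t ha ih =>
      rw [Finset.prod_insert ha, ih, Finset.sum_insert ha, X, monomial_mul_monomial, one_mul]
  have happ : ∀ (t : Finset ℕ+) (b : ℕ+),
      (∑ a ∈ t, Finsupp.single a 1 : ℕ+ →₀ ℕ) b = if b ∈ t then 1 else 0 := fun t b => by
    simp [Finsupp.finsetSum_apply, Finsupp.single_apply]
  ext1 m
  rw [coeff_truncateVars, map_sum]
  simp only [hprod, coeff_monomial]
  change (if _ then (if m.degree = n ∧ ∀ a, m a ≤ 1 then (1 : Coeff) else 0) else 0) = _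
  -- At most one set `t` contributes to the coefficient of `m`, namely the support of `m`.
  have hm : ∀ t : Finset ℕ+, m = ∑ a ∈ t, Finsupp.single a 1 ↔
      t = m.support ∧ ∀ a, m a ≤ 1 := fun t => by
    constructor
    · rintro rfl
      refine ⟨?_, fun a => ?_⟩
      · ext b
        rw [Finsupp.mem_support_iff, happ]
        simp
      · rw [happ]
        split_ifs <;> simp
    · rintro ⟨rfl, h⟩
      ext b
      rw [happ]
      have := h b
      split_ifs with hb <;> rw [Finsupp.mem_support_iff] at hb <;> omega
  have hdeg : (∀ a, m a ≤ 1) → m.degree = m.support.card := fun h => by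
    rw [Finsupp.degree_apply, Finset.card_eq_sum_ones]
    refine Finset.sum_congr rfl fun a ha => ?_
    have := h a
    have := Finsupp.mem_support_iff.1 ha
    omega
  by_cases h1 : ∀ a, m a ≤ 1
  · simp only [hm, h1, implies_true, and_true]
    rw [Finset.sum_ite_eq', ← ite_and, hdeg h1]
    refine if_congr ?_ rfl rfl
    rw [Finset.mem_powersetCard]
    refine and_congr_left fun _ => ?_
    simp [Finset.subset_iff]
  · simp [hm, h1]

/-- The indices `1, …, N`. -/
def firstVars (N : ℕ) : Set ℕ+ := {i | (i : ℕ) ≤ N}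

theorem firstVars_eq (N : ℕ) :
    firstVars N = (((Finset.range N).image Nat.succPNat : Finset ℕ+) : Set ℕ+) := by
  ext i
  simp only [firstVars, Set.mem_ofPred_eq, Finset.coe_image, Finset.coe_range, Set.mem_image,
    Set.mem_Iio]
  constructor
  · intro h
    have := i.pos
    exact ⟨i.natPred, by rw [PNat.natPred]; omega, PNat.succPNat_natPred i⟩
  · rintro ⟨n, hn, rfl⟩
    exact hn

theorem card_firstVars (N : ℕ) : ((Finset.range N).image Nat.succPNat).card = N := by
  rw [Finset.card_image_of_injective _ Nat.succPNat_injective, Finset.card_range]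

theorem truncateVars_elemSymm_eq_zero {N n : ℕ} (h : N < n) :
    truncateVars Coeff (firstVars N) (elemSymm n) = 0 := by
  rw [firstVars_eq, truncateVars_elemSymm, Finset.powersetCard_eq_empty.2, Finset.sum_empty]
  rwa [card_firstVars]

theorem prod_one_add_X_mul (N : ℕ) (u : Series) :
    ∏ n ∈ Finset.range N, (1 + truncateVars Coeff (firstVars N) (X n.succPNat) * u) =
      1 + ∑ n ∈ Finset.range N, truncateVars Coeff (firstVars N) (elemSymm (n + 1)) *
        u ^ (n + 1) := by
  have h : ∏ n ∈ Finset.range N, (1 + truncateVars Coeff (firstVars N) (X n.succPNat) * u) =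
      ∏ a ∈ (Finset.range N).image Nat.succPNat, (1 + X a * u) := by
    rw [Finset.prod_image Nat.succPNat_injective.injOn]
    refine Finset.prod_congr rfl fun n hn => ?_
    rw [truncateVars_X]
    exact Finset.mem_range.1 hn
  rw [h, Finset.prod_one_add, Finset.sum_powerset, card_firstVars, Finset.sum_range_succ',
    add_comm]
  congr 1
  · simp
  · refine Finset.sum_congr rfl fun n _ => ?_
    rw [firstVars_eq, truncateVars_elemSymm, Finset.sum_mul]
    refine Finset.sum_congr rfl fun t ht => ?_
    rw [Finset.prod_mul_distrib, Finset.prod_const, (Finset.mem_powersetCard.1 ht).2]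

theorem degree_of_coeff_elemSymm_ne_zero {n : ℕ} {m : ℕ+ →₀ ℕ}
    (h : coeff m (elemSymm n) ≠ 0) : m.degree = n := by
  by_contra h'
  exact h (if_neg fun h'' => h' h''.1)

theorem constantCoeff_elemSymm (n : ℕ) : constantCoeff (elemSymm (n + 1)) = 0 := by
  rw [← coeff_zero_eq_constantCoeff_apply]
  by_contra h
  simpa using degree_of_coeff_elemSymm_ne_zero h

/-- The product `∏ e_k` over the elements `k` of a multiset. -/
def elemSymmProd (s : Multiset ℕ) : Series := (s.map elemSymm).prod

theorem elemSymmProd_add (s t : Multiset ℕ) :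
    elemSymmProd (s + t) = elemSymmProd s * elemSymmProd t := by
  simp [elemSymmProd]

theorem degree_eq_of_coeff_elemSymmProd_ne_zero {s : Multiset ℕ} {m : ℕ+ →₀ ℕ}
    (h : coeff m (elemSymmProd s) ≠ 0) : m.degree = s.sum := by
  classical
  induction s using Multiset.induction_on generalizing m with
  | empty =>
    rw [elemSymmProd, Multiset.map_zero, Multiset.prod_zero, coeff_one] at h
    rw [show m = 0 by by_contra h'; exact h (if_neg h')]
    simp
  | cons n s ih =>
    rw [← Multiset.singleton_add, elemSymmProd_add, coeff_mul] at h
    obtain ⟨p, hp, hne⟩ := Finset.exists_ne_zero_of_sum_ne_zero h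
    rw [← Finset.HasAntidiagonal.mem_antidiagonal.1 hp, Finsupp.degree.map_add,
      ih (right_ne_zero_of_mul hne), Multiset.sum_cons]
    congr 1
    have h1 := left_ne_zero_of_mul hne
    rw [elemSymmProd, Multiset.map_singleton, Multiset.prod_singleton] at h1
    exact degree_of_coeff_elemSymm_ne_zero h1

theorem coeffFinite_elemSymmProd {A : Type*} (w : A → Coeff) {lab : A → Multiset ℕ}
    (h : ∀ d, {a | (lab a).sum = d}.Finite) :
    CoeffFinite fun a => C (w a) * elemSymmProd (lab a) := fun m =>
  (h m.degree).subset fun a ha => by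
    rw [Function.mem_support, coeff_C_mul] at ha
    exact (degree_eq_of_coeff_elemSymmProd_ne_zero (right_ne_zero_of_mul ha)).symm

end ElemSymm

/-! ### The generating function of ordered red/black trees -/

section OrderedTrees

open MvPowerSeries

mutual
  theorem RedTree.labels_pos : ∀ (t : RedTree), ∀ x ∈ t.labels, 0 < x
    | .node b bs => fun x hx => by
      rw [RedTree.labels, Multiset.mem_add] at hx
      exact hx.elim (b.labels_pos x) (labelsBlackList_pos bs x)
  theorem BlackTree.labels_pos : ∀ (b : BlackTree), ∀ x ∈ b.labels, 0 < x
    | .node r cs => fun x hx => by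
      rw [BlackTree.labels, Multiset.mem_add, Multiset.mem_singleton] at hx
      exact hx.elim (fun h => h ▸ r.pos) (labelsRedList_pos cs x)
  theorem labelsBlackList_pos : ∀ (bs : List BlackTree), ∀ x ∈ labelsBlackList bs, 0 < x
    | [] => fun x hx => by simp [labelsBlackList] at hx
    | b :: bs => fun x hx => by
      rw [labelsBlackList, Multiset.mem_add] at hx
      exact hx.elim (b.labels_pos x) (labelsBlackList_pos bs x)
  theorem labelsRedList_pos : ∀ (ts : List RedTree), ∀ x ∈ labelsRedList ts, 0 < x
    | [] => fun x hx => by simp [labelsRedList] at hx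
    | t :: ts => fun x hx => by
      rw [labelsRedList, Multiset.mem_add] at hx
      exact hx.elim (t.labels_pos x) (labelsRedList_pos ts x)
end

theorem card_le_sum_of_pos {s : Multiset ℕ} (h : ∀ x ∈ s, 0 < x) : Multiset.card s ≤ s.sum := by
  simpa using Multiset.card_nsmul_le_sum (s := s) (a := 1) h

theorem finite_blackTree_sum (d : ℕ) : {b : BlackTree | b.labels.sum = d}.Finite :=
  (finite_ordered_aux (Multiset.range (d + 1)) d).1.subset fun b hb => by
    have hb : b.labels.sum = d := hb
    exact ⟨hb ▸ card_le_sum_of_pos b.labels_pos, fun x hx =>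
      Multiset.mem_range.2 (Nat.lt_succ_of_le (hb ▸ Multiset.le_sum_of_mem hx))⟩

theorem finite_redTree_sum (d : ℕ) : {t : RedTree | t.labels.sum = d}.Finite :=
  (finite_ordered_aux (Multiset.range (d + 1)) d).2.subset fun b hb => by
    have hb : b.labels.sum = d := hb
    exact ⟨hb ▸ card_le_sum_of_pos b.labels_pos, fun x hx =>
      Multiset.mem_range.2 (Nat.lt_succ_of_le (hb ▸ Multiset.le_sum_of_mem hx))⟩

/-- A list of red trees is the list of children of a black root, so that finiteness for lists follows
from finiteness for trees. -/
theorem finite_redList_sum (d : ℕ) : {ts : List RedTree | (labelsRedList ts).sum = d}.Finite :=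
  ((finite_blackTree_sum (1 + d)).preimage (f := BlackTree.node 1)
    (fun _ _ _ _ h => (BlackTree.node.inj h).2)).subset fun ts hts => by
      have hts : (labelsRedList ts).sum = d := hts
      simp [BlackTree.labels, hts]

theorem finite_blackList_sum (d : ℕ) :
    {bs : List BlackTree | (labelsBlackList bs).sum = d}.Finite :=
  ((finite_redTree_sum (1 + d)).preimage (f := RedTree.node (.node 1 []))
    (fun _ _ _ _ h => (RedTree.node.inj h).2)).subset fun bs hbs => by
      have hbs : (labelsBlackList bs).sum = d := hbs
      simp [RedTree.labels, BlackTree.labels, labelsRedList, hbs]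

/-- The contribution of an ordered tree with a red root to the generating function. -/
def redTerm (t : RedTree) : Series := C t.nodeWeight * elemSymmProd t.labels

/-- The contribution of an ordered tree with a black root, the weight of the root being given
by `q`. -/
def blackTerm (q : ℕ → ℕ → Coeff) (b : BlackTree) : Series :=
  C (b.nodeWeight q) * elemSymmProd b.labels

/-- The contribution of a list of trees with red roots. -/
def redListTerm (ts : List RedTree) : Series :=
  C (nodeWeightRedList ts) * elemSymmProd (labelsRedList ts)

/-- The contribution of a list of trees with black roots, joined to a common parent by black edges. -/
def blackListTerm (bs : List BlackTree) : Series :=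
  C (nodeWeightBlackList bs) * elemSymmProd (labelsBlackList bs)

theorem coeffFinite_redTerm : CoeffFinite redTerm :=
  coeffFinite_elemSymmProd _ finite_redTree_sum

theorem coeffFinite_blackTerm (q : ℕ → ℕ → Coeff) : CoeffFinite (blackTerm q) :=
  coeffFinite_elemSymmProd _ finite_blackTree_sum

theorem coeffFinite_redListTerm : CoeffFinite redListTerm :=
  coeffFinite_elemSymmProd _ finite_redList_sum

theorem coeffFinite_blackListTerm : CoeffFinite blackListTerm :=
  coeffFinite_elemSymmProd _ finite_blackList_sum

/-- The generating function of all ordered red/black trees, with each label `k` contributing `e_k`. -/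
def redGF : Series := coeffSum redTerm

theorem redGF_eq_mul : redGF = coeffSum (blackTerm pRed) * coeffSum blackListTerm := by
  rw [← coeffSum_mul (coeffFinite_blackTerm _) coeffFinite_blackListTerm, redGF,
    ← coeffSum_comp_injective redTerm (g := fun p : BlackTree × List BlackTree => .node p.1 p.2)
      (fun p q h => Prod.ext (RedTree.node.inj h).1 (RedTree.node.inj h).2)
      fun t ht => absurd (by cases t with | node b bs => exact ⟨(b, bs), rfl⟩) ht]
  refine congrArg coeffSum (funext fun p => ?_)
  simp only [redTerm, blackTerm, blackListTerm, RedTree.nodeWeight, RedTree.labels,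
    elemSymmProd_add, map_mul]
  ring

theorem coeffSum_blackListTerm : coeffSum blackListTerm =
    1 + coeffSum (blackTerm pBlack) * coeffSum blackListTerm := by
  conv_lhs => rw [coeffSum_list coeffFinite_blackListTerm]
  rw [← coeffSum_mul (coeffFinite_blackTerm _) coeffFinite_blackListTerm]
  congr 1
  · simp [blackListTerm, nodeWeightBlackList, labelsBlackList, elemSymmProd]
  · refine congrArg coeffSum (funext fun p => ?_)
    simp only [blackTerm, blackListTerm, nodeWeightBlackList, labelsBlackList,
      elemSymmProd_add, map_mul]
    ring

/-- Either the root has no child other than the one joined to it by the red edge, or it has a first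
child joined by a black edge, whose removal leaves an arbitrary tree with a red root. -/
theorem redGF_eq : redGF = coeffSum (blackTerm pRed) + coeffSum (blackTerm pBlack) * redGF := by
  conv_lhs => rw [redGF_eq_mul, coeffSum_blackListTerm]
  rw [redGF_eq_mul]
  ring

theorem coeffSum_redListTerm_length (k : ℕ) :
    (coeffSum fun ts => if ts.length = k then redListTerm ts else 0) = redGF ^ k := by
  induction k with
  | zero =>
    rw [coeffSum_list (coeffFinite_redListTerm.ite _)]
    simp only [List.length_nil, List.length_cons, Nat.succ_ne_zero, if_true, if_false, pow_zero]
    rw [show (coeffSum fun _ : RedTree × List RedTree => (0 : Series)) = 0 by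
      ext1 m; simp [coeff_coeffSum]]
    simp [redListTerm, nodeWeightRedList, labelsRedList, elemSymmProd]
  | succ k ih =>
    rw [coeffSum_list (coeffFinite_redListTerm.ite _), pow_succ', ← ih, redGF,
      ← coeffSum_mul coeffFinite_redTerm (coeffFinite_redListTerm.ite _)]
    simp only [List.length_nil, List.length_cons, (Nat.succ_ne_zero k).symm, if_false, zero_add,
      Nat.add_right_cancel_iff]
    refine congrArg coeffSum (funext fun p => ?_)
    split_ifs
    · simp only [redTerm, redListTerm, nodeWeightRedList, labelsRedList,
        elemSymmProd_add, map_mul]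
      ring
    · simp

theorem coeffSum_blackTerm_label {q : ℕ → ℕ → Coeff} (r : ℕ+) (hq : ∀ k, (r : ℕ) < k → q r k = 0) :
    (coeffSum fun b => if b.label = r then blackTerm q b else 0) =
      elemSymm r * ∑ k ∈ Finset.range (r + 1), C (q r k) * redGF ^ k := by
  rw [← coeffSum_comp_injective _ (g := BlackTree.node r)
    (fun _ _ h => (BlackTree.node.inj h).2) fun b hb => by
      cases b with
      | node r' cs => exact if_neg fun h => hb ⟨cs, by rw [← h, BlackTree.label]⟩]
  have h : ∀ cs, blackTerm q (.node r cs) = ∑ k ∈ Finset.range (r + 1),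
      elemSymm r * C (q r k) * if cs.length = k then redListTerm cs else 0 := fun cs => by
    simp only [mul_ite, mul_zero]
    rw [Finset.sum_ite_eq]
    simp only [blackTerm, BlackTree.nodeWeight, BlackTree.labels, redListTerm, elemSymmProd_add,
      map_mul]
    rw [elemSymmProd, Multiset.map_singleton, Multiset.prod_singleton]
    split_ifs with hk
    · ring
    · rw [hq _ (by simpa using hk)]
      simp
  simp only [BlackTree.label, if_true, h]
  rw [coeffSum_finset_sum _ fun k _ => (coeffFinite_redListTerm.ite _).const_mul _,
    Finset.mul_sum]
  refine Finset.sum_congr rfl fun k _ => ?_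
  rw [coeffSum_const_mul (coeffFinite_redListTerm.ite _), coeffSum_redListTerm_length, mul_assoc]

/-- Only labels at most `N` survive the truncation to `x₁, …, x_N`, since `e_r(x₁, …, x_N) = 0` for
`r > N`; this makes the sum over the label of the root finite. -/
theorem truncateVars_coeffSum_blackTerm {q : ℕ → ℕ → Coeff} (hq : ∀ r k, r < k → q r k = 0)
    (N : ℕ) : truncateVars Coeff (firstVars N) (coeffSum (blackTerm q)) =
      ∑ n ∈ Finset.range N, truncateVars Coeff (firstVars N) (elemSymm (n + 1)) *
        ∑ k ∈ Finset.range (n + 2),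
          C (q (n + 1) k) * truncateVars Coeff (firstVars N) redGF ^ k := by
  have h : ∀ b, truncateVars Coeff (firstVars N) (blackTerm q b) = ∑ n ∈ Finset.range N,
      truncateVars Coeff (firstVars N)
        (if b.label = n.succPNat then blackTerm q b else 0) := fun b => by
    rw [← map_sum]
    by_cases hb : (b.label : ℕ) ≤ N
    · rw [Finset.sum_eq_single b.label.natPred, if_pos (PNat.succPNat_natPred _).symm]
      · exact fun n _ hn => if_neg fun h => hn (by rw [h, Nat.natPred_succPNat])
      · intro hn
        have := b.label.pos
        rw [Finset.mem_range, PNat.natPred] at hn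
        omega
    · rw [Finset.sum_eq_zero fun n hn => if_neg fun h => hb ?_, map_zero]
      · cases b with
        | node r cs =>
          rw [blackTerm, BlackTree.labels, elemSymmProd_add, elemSymmProd,
            Multiset.map_singleton, Multiset.prod_singleton, map_mul, map_mul,
            truncateVars_elemSymm_eq_zero (n := r) (not_le.1 hb)]
          simp
      · rw [h]
        exact Finset.mem_range.1 hn
  rw [truncateVars_coeffSum]
  simp only [h]
  rw [coeffSum_finset_sum _ fun n _ => ((coeffFinite_blackTerm q).ite _).truncateVars _]
  refine Finset.sum_congr rfl fun n _ => ?_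
  rw [← truncateVars_coeffSum, coeffSum_blackTerm_label _ (hq _)]
  simp [truncateVars_C]

theorem weightTerm_eq_zero {n k i : ℕ} (h : n < k) : weightTerm n k i = 0 :=
  Finset.sum_eq_zero fun j _ => if_neg (by omega)

theorem pBlack_eq_zero {r k : ℕ} (h : r < k) : pBlack r k = 0 :=
  Finset.sum_eq_zero fun _ _ => weightTerm_eq_zero h

theorem pRed_eq_zero {r k : ℕ} (h : r ≤ k) : pRed r k = 0 :=
  Finset.sum_eq_zero fun i hi => weightTerm_eq_zero (by
    have := Finset.mem_range.1 hi
    omega)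

end OrderedTrees

/-! ### Comparison of the two generating functions -/

section FunctionalEquations

open MvPowerSeries

/-- Extension of the coefficients from `ℕ` to `ℤ`, which makes subtraction and cancellation
available. -/
def intSeries : Series →+* MvPowerSeries ℕ+ (MvPolynomial EdgeVar ℤ) :=
  MvPowerSeries.map (MvPolynomial.map (Nat.castRingHom ℤ))

theorem intSeries_injective : Function.Injective intSeries := by
  intro f g h
  ext1 m
  have := congrArg (coeff m) h
  rw [intSeries, coeff_map, coeff_map] at this
  exact MvPolynomial.map_injective _ Nat.cast_injective this

/-- The equation `G = ∑ eₙ ∑ p̄(n,k) Gᵏ + G ∑ eₙ ∑ p(n,k) Gᵏ` for power series in `x₁, …, x_N`. -/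
def IsFixedPoint (N : ℕ) (G : Series) : Prop :=
  G = ∑ n ∈ Finset.range N, truncateVars Coeff (firstVars N) (elemSymm (n + 1)) *
    (∑ k ∈ Finset.range (n + 2), C (pRed (n + 1) k) * G ^ k +
      G * ∑ k ∈ Finset.range (n + 2), C (pBlack (n + 1) k) * G ^ k)

theorem IsFixedPoint.eq {N : ℕ} {G H : Series} (hG : IsFixedPoint N G) (hH : IsFixedPoint N H) :
    G = H := by
  refine intSeries_injective (eq_of_fixedPoint (Finset.range N)
    (fun n => intSeries (truncateVars Coeff (firstVars N) (elemSymm (n + 1))))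
    (fun n => ∑ k ∈ Finset.range (n + 2),
        Polynomial.C (intSeries (C (pRed (n + 1) k))) * Polynomial.X ^ k +
      Polynomial.X * ∑ k ∈ Finset.range (n + 2),
        Polynomial.C (intSeries (C (pBlack (n + 1) k))) * Polynomial.X ^ k) ?_ ?_ ?_)
  · intro n _
    rw [intSeries, constantCoeff_map, constantCoeff_truncateVars, constantCoeff_elemSymm,
      map_zero]
  · simpa [Polynomial.eval_finsetSum] using congrArg intSeries hG
  · simpa [Polynomial.eval_finsetSum] using congrArg intSeries hH

theorem isFixedPoint_redGF (N : ℕ) :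
    IsFixedPoint N (truncateVars Coeff (firstVars N) redGF) := by
  have h := congrArg (truncateVars Coeff (firstVars N)) redGF_eq
  rw [map_add, map_mul, truncateVars_coeffSum_blackTerm fun r k h => pRed_eq_zero h.le,
    truncateVars_coeffSum_blackTerm fun r k h => pBlack_eq_zero h] at h
  refine h.trans ?_
  rw [Finset.sum_mul, ← Finset.sum_add_distrib]
  refine Finset.sum_congr rfl fun n _ => ?_
  ring

theorem isFixedPoint_smirnovGF (N : ℕ) :
    IsFixedPoint N (truncateVars Coeff (firstVars N) smirnovGF) := by
  set ψ := truncateVars Coeff (firstVars N) with hψ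
  let φ := intSeries.comp ψ
  have hψφ : ∀ f, intSeries (ψ f) = φ f := fun _ => rfl
  have hφC : ∀ c, φ (C c) = intSeries (C c) := fun c => by rw [← hψφ, hψ, truncateVars_C]
  have hconst : ∀ f, constantCoeff f = 0 → constantCoeff (φ f) = 0 := fun f hf => by
    rw [← hψφ, intSeries, constantCoeff_map, hψ, constantCoeff_truncateVars, hf, map_zero]
  have hG0 : constantCoeff smirnovGF = 0 := by
    rw [smirnovGF_eq_rootSum]
    exact constantCoeff_rootSum (by simp)
  have hA0 : ∀ i, constantCoeff (rootSum (RootLT i)) = 0 := fun i =>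
    constantCoeff_rootSum (by simp [RootLT])
  have hmob := mobius_telescope (φ (C Coeff.lb)) (φ (C Coeff.la)) (φ (C Coeff.ρb)) (φ (C Coeff.ρ))
    (φ smirnovGF) (fun n => φ (X n.succPNat)) (fun n => φ (rootSum (RootLT n.succPNat)))
    (fun n => φ (rootSum (· = some n.succPNat))) (fun n => φ (rootSum (RootGT n.succPNat))) N
    (by rw [rootSum_zero, map_zero])
    (congrArg intSeries (truncateVars_rootSum N))
    (fun n => by rw [rootSum_succ, map_add])
    (fun n => by rw [← map_add, ← map_add, ← smirnovGF_eq])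
    (fun n => by
      conv_lhs => rw [rootSum_eq_some]
      simp only [map_mul, map_add, map_one])
    (fun n h => by
      have := congrArg constantCoeff h
      rw [map_add, map_add, map_mul, map_mul, map_sub, hconst _ (hA0 _), hconst _ hG0] at this
      simp at this)
  set G := ψ smirnovGF with hG
  let u : Series := (C (Coeff.ρb + Coeff.lb) + C (Coeff.ρb * Coeff.lb) * G)
  let v : Series := (C (Coeff.ρ + Coeff.la) + C (Coeff.ρ * Coeff.la) * G)
  have hu : φ (C Coeff.ρb) + φ (C Coeff.lb) + φ (C Coeff.ρb) * φ (C Coeff.lb) * φ smirnovGF =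
      intSeries u := by
    simp only [u, hφC, map_add, map_mul, hG, hψφ]
  have hv : φ (C Coeff.ρ) + φ (C Coeff.la) + φ (C Coeff.ρ) * φ (C Coeff.la) * φ smirnovGF =
      intSeries v := by
    simp only [v, hφC, map_add, map_mul, hG, hψφ]
  have hprod : ∀ w : Series, ∏ n ∈ Finset.range N, (1 + φ (X n.succPNat) * intSeries w) =
      1 + ∑ n ∈ Finset.range N, intSeries (ψ (elemSymm (n + 1))) * intSeries w ^ (n + 1) :=
    fun w => by
      have h := congrArg intSeries (prod_one_add_X_mul N w)
      simp only [map_prod, map_add, map_one, map_mul, map_sum, map_pow] at h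
      exact h
  rw [hu, hv, hprod, hprod] at hmob
  have huv : intSeries u ≠ intSeries v := fun h => by
    have h1 := congrArg constantCoeff (intSeries_injective h)
    have h2 : constantCoeff G = 0 := by
      rw [hG, hψ, constantCoeff_truncateVars, hG0]
    simp only [u, v, map_add, map_mul, h2, constantCoeff_C, mul_zero, add_zero] at h1
    classical
    have h3 := congrArg (MvPolynomial.coeff (Finsupp.single EdgeVar.rhoBar 1)) h1
    simp [Coeff.ρb, Coeff.lb, Coeff.ρ, Coeff.la, MvPolynomial.coeff_X, Finsupp.single_left_inj] at h3
  have hfin := functional_equation huv (fun n => intSeries (ψ (elemSymm n))) N hmob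
  refine intSeries_injective ?_
  rw [hψφ]
  refine hfin.trans ?_
  rw [map_sum]
  refine Finset.sum_congr rfl fun n _ => ?_
  rw [sum_pRed C G n, sum_pBlack C G n]
  simp only [u, v, map_mul, map_add, map_sum, map_pow, hG, ← hψ, hψφ]

/-- The two generating functions agree, since each coefficient involves only finitely many variables
and is therefore seen by some truncation. -/
theorem smirnovGF_eq_redGF : smirnovGF = redGF := by
  ext1 m
  have hm : ∀ a, m a ≠ 0 → a ∈ firstVars (m.support.sup fun a => (a : ℕ)) := fun a ha =>
    Finset.le_sup (f := fun a : ℕ+ => (a : ℕ)) (Finsupp.mem_support_iff.2 ha)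
  rw [← coeff_truncateVars_of_forall smirnovGF hm, ← coeff_truncateVars_of_forall redGF hm,
    (isFixedPoint_smirnovGF _).eq (isFixedPoint_redGF _)]

end FunctionalEquations

/-! ### From ordered to unordered trees -/

section UnorderedTrees

mutual
  /-- The sum over bleeding trees may be extended to all trees: `p(r,k) = 0` for `k > r` and for
  `r = 1`, and `p̄(r,k) = 0` for `k ≥ r`. -/
  theorem RedTree.isBleeding_of_nodeWeight_ne_zero :
      ∀ t : RedTree, t.nodeWeight ≠ 0 → t.IsBleeding
    | .node b bs => fun h => by
      rw [RedTree.nodeWeight] at h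
      have hb := b.isBleeding_of_nodeWeight_ne_zero pRed (left_ne_zero_of_mul h)
      have hbs := isBleeding_of_nodeWeightBlackList_ne_zero bs (right_ne_zero_of_mul h)
      refine .node ?_ hb.2 (fun c hc => ⟨?_, ?_⟩) fun c hc => (hbs c hc).2
      · by_contra hlt
        exact hb.1 (pRed_eq_zero (not_lt.1 hlt))
      · by_contra hlt
        exact (hbs c hc).1 (pBlack_eq_zero (not_le.1 hlt))
      · intro h1
        refine (hbs c hc).1 ?_
        rw [h1]
        rfl
  theorem BlackTree.isBleeding_of_nodeWeight_ne_zero (q : ℕ → ℕ → Coeff) :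
      ∀ b : BlackTree, b.nodeWeight q ≠ 0 → q b.label b.numChildren ≠ 0 ∧ b.IsBleeding
    | .node r cs => fun h => by
      rw [BlackTree.nodeWeight] at h
      exact ⟨left_ne_zero_of_mul h,
        .node (isBleeding_of_nodeWeightRedList_ne_zero cs (right_ne_zero_of_mul h))⟩
  theorem isBleeding_of_nodeWeightBlackList_ne_zero :
      ∀ bs : List BlackTree, nodeWeightBlackList bs ≠ 0 →
        ∀ c ∈ bs, pBlack c.label c.numChildren ≠ 0 ∧ c.IsBleeding
    | [] => fun _ c hc => by simp at hc
    | b :: bs => fun h => by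
      rw [nodeWeightBlackList] at h
      rw [List.forall_mem_cons]
      exact ⟨b.isBleeding_of_nodeWeight_ne_zero pBlack (left_ne_zero_of_mul h),
        isBleeding_of_nodeWeightBlackList_ne_zero bs (right_ne_zero_of_mul h)⟩
  theorem isBleeding_of_nodeWeightRedList_ne_zero :
      ∀ ts : List RedTree, nodeWeightRedList ts ≠ 0 → ∀ t ∈ ts, t.IsBleeding
    | [] => fun _ c hc => by simp at hc
    | t :: ts => fun h => by
      rw [nodeWeightRedList] at h
      rw [List.forall_mem_cons]
      exact ⟨t.isBleeding_of_nodeWeight_ne_zero (left_ne_zero_of_mul h),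
        isBleeding_of_nodeWeightRedList_ne_zero ts (right_ne_zero_of_mul h)⟩
end

/-- The weights of the unordered bleeding trees, which count orbits, add up to the weights of all
ordered trees with the same labels. -/
theorem sum_weight_bleedingTrees {n : ℕ} (π : n.Partition) :
    ∑ U ∈ bleedingTrees π, U.weight =
      ∑ t ∈ (finite_ordered π.parts).toFinset, t.nodeWeight := by
  classical
  have hbl : ∀ U : UnorderedTree, U ∈ bleedingTrees π ↔ U.IsBleeding ∧ U.labels = π.parts :=
    fun U => by simp [bleedingTrees]
  have horb : ∀ U ∈ bleedingTrees π, U.weight =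
      ∑ t ∈ (finite_ordered π.parts).toFinset with (⟦t⟧ : UnorderedTree) = U, t.nodeWeight := by
    intro U hU
    have h : ((finite_ordered π.parts).toFinset.filter fun t => (⟦t⟧ : UnorderedTree) = U) =
        U.finite_orbit.toFinset := by
      ext t
      simp only [Finset.mem_filter, Set.Finite.mem_toFinset]
      refine ⟨fun h => h.2, fun h => ⟨?_, h⟩⟩
      have h' : (⟦t⟧ : UnorderedTree) = U := h
      have := ((hbl U).1 hU).2
      rw [← h'] at this
      exact this
    rw [h, UnorderedTree.weight, Set.ncard_eq_toFinset_card _ U.finite_orbit, ← nsmul_eq_mul,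
      ← Finset.sum_const]
    refine Finset.sum_congr rfl fun t ht => ?_
    have h' : (⟦t⟧ : UnorderedTree) = U := U.finite_orbit.mem_toFinset.1 ht
    rw [← h']
    rfl
  rw [Finset.sum_congr rfl horb]
  refine (Finset.sum_fiberwise_eq_sum_filter _ _ _ _).trans ?_
  refine Finset.sum_subset (Finset.filter_subset _ _) fun t ht ht' => ?_
  by_contra h
  refine ht' (Finset.mem_filter.2 ⟨ht, (hbl _).2
    ⟨t.isBleeding_of_nodeWeight_ne_zero h, ?_⟩⟩)
  exact (finite_ordered π.parts).mem_toFinset.1 ht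

/-- The labels of an ordered tree as a partition. -/
def RedTree.partition (t : RedTree) : PosPartition :=
  ⟨⟨t.labels.sum, (t.card_labels_pos).trans_le (card_le_sum_of_pos t.labels_pos)⟩,
    ⟨t.labels, fun {i} hi => t.labels_pos i hi, rfl⟩⟩

theorem RedTree.partition_eq_iff (t : RedTree) (π : PosPartition) :
    t.partition = π ↔ t.labels = π.2.parts := by
  constructor
  · rintro rfl
    rfl
  · intro h
    obtain ⟨⟨n, hn⟩, ⟨s, hs, hsum⟩⟩ := π
    obtain rfl : t.labels = s := h
    change t.labels.sum = n at hsum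
    subst hsum
    rfl

theorem finsum_fiberwise {A B M : Type*} [AddCommMonoid M] [DecidableEq B] (f : A → M)
    (hf : (Function.support f).Finite) (p : A → B) :
    ∑ᶠ b, ∑ᶠ a, (if p a = b then f a else 0) = ∑ᶠ a, f a := by
  have h : ∀ b, ∑ᶠ a, (if p a = b then f a else 0) =
      ∑ a ∈ hf.toFinset, if p a = b then f a else 0 := fun b =>
    finsum_eq_sum_of_support_subset _ fun a ha => by
      rw [hf.coe_toFinset]
      intro h0
      exact ha (by simp [h0])
  simp only [h]
  rw [finsum_sum_comm, finsum_eq_sum_of_support_subset f hf.coe_toFinset.ge]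
  · refine Finset.sum_congr rfl fun a _ => ?_
    rw [finsum_eq_single _ (p a) fun b hb => if_neg hb.symm, if_pos rfl]
  · intro a _
    refine (Set.finite_singleton (p a)).subset fun b hb => ?_
    by_contra hne
    exact hb (if_neg fun h => hne h.symm)

theorem hasEExpansion_smirnovGF :
    HasEExpansion smirnovGF fun π => ∑ U ∈ bleedingTrees π.2, U.weight := by
  classical
  intro m
  have hfin := coeffFinite_redTerm m
  have hterm : ∀ π : PosPartition, MvPowerSeries.coeff m
      (MvPowerSeries.C (∑ U ∈ bleedingTrees π.2, U.weight) * elemSymmPart π.2) =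
      ∑ᶠ t : RedTree, if t.partition = π then MvPowerSeries.coeff m (redTerm t) else 0 := by
    intro π
    rw [sum_weight_bleedingTrees, map_sum, Finset.sum_mul, map_sum, ← finsum_mem_coe_finset]
    refine finsum_congr fun t => ?_
    by_cases h : t.labels = π.2.parts
    · simp [h, RedTree.partition_eq_iff, redTerm, elemSymmProd, elemSymmPart]
    · simp [h, RedTree.partition_eq_iff]
  simp only [hterm]
  constructor
  · refine (hfin.image RedTree.partition).subset fun π hπ => ?_
    by_contra h
    refine hπ (finsum_eq_zero_of_forall_eq_zero fun t => ?_)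
    rw [ite_eq_right_iff]
    intro ht
    by_contra h'
    exact h ⟨t, h', ht⟩
  · rw [smirnovGF_eq_redGF, redGF, coeff_coeffSum]
    exact (finsum_fiberwise _ hfin RedTree.partition).symm

end UnorderedTrees

end

theorem mainTheorem3 :
    IsEPositive smirnovGF ∧
      HasEExpansion smirnovGF fun π => ∑ U ∈ bleedingTrees π.2, U.weight :=
  ⟨⟨_, hasEExpansion_smirnovGF⟩, hasEExpansion_smirnovGF⟩
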